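/- **Lemma (sum of Jordan canonical matrices).** For $n\ge 1$ let $J_n$ be the $n\times n$ complex nilpotent Jordan cell (eigenvalue $0$, ones on the superdiagonal, zeros elsewhere). Write $A\sim B$ if $A=OBO^{-1}$ for some invertible complex matrix $O$. Let $d_1,\dots,d_4\ge 1$ be integers, and let $$\mathcal H = J_{d_1}\otimes 1\otimes 1\otimes 1+1\otimes J_{d_2}\otimes 1\otimes 1+1\otimes 1\otimes J_{d_3}\otimes 1+1\otimes 1\otimes 1\otimes J_{d_4}$$ be the Kronecker sum of the four nilpotent Jordan cells, acting on $\mathbb C^{d_1}\otimes\mathbb C^{d_2}\otimes\mathbb C^{d_3}\otimes\mathbb C^{d_4}$. For integers $D\ge 0$ put $$C^D_{\vec d}=\frac1\pi\int_0^{2\pi}\frac{\sin(D\phi)\prod_{\alpha=1}^4\sin(d_\alpha\phi)}{(\sin\phi)^3}\,d\phi .$$ The integrand is integrable. For every $D\ge 1$ the number $C^D_{\vec d}$ is a non-negative integer, equal to the multiplicity of the irreducible representation of $\mathrm{SU}(2)$ of dimension $D$ in the tensor product of the irreducible representations of dimensions $d_1,d_2,d_3,d_4$, and $$\mathcal H\;\sim\;\bigoplus_{D=1}^{d_1+d_2+d_3+d_4-3}\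 \bigoplus_{k=1}^{C^D_{\vec d}}J_D .$$ In particular, $C^D_{\vec d}=0$ whenever $D-\sum_\alpha d_\alpha$ is even. -/

import Mathlib

open scoped Kronecker

/-- The Jordan cell of size `n` with eigenvalue `0`: ones on the superdiagonal, zeros elsewhere. -/
def nilpotentJordanCell (n : ℕ) : Matrix (Fin n) (Fin n) ℂ :=
  Matrix.of fun i j => if (i : ℕ) + 1 = (j : ℕ) then 1 else 0

/-- The Kronecker sum `A ⊗ 1 + 1 ⊗ B`, i.e. the operator `A + B` where `A` and `B` act on the two
factors of a tensor product. -/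
def kroneckerSum {m n : Type*} [DecidableEq m] [DecidableEq n]
    (A : Matrix m m ℂ) (B : Matrix n n ℂ) : Matrix (m × n) (m × n) ℂ :=
  A ⊗ₖ (1 : Matrix n n ℂ) + (1 : Matrix m m ℂ) ⊗ₖ B

/-- The Kronecker sum of four nilpotent Jordan cells of sizes `d 0, d 1, d 2, d 3`, acting on
`ℂ^(d 0) ⊗ ℂ^(d 1) ⊗ ℂ^(d 2) ⊗ ℂ^(d 3)`. -/
def jordanCellSum (d : Fin 4 → ℕ) :
    Matrix (((Fin (d 0) × Fin (d 1)) × Fin (d 2)) × Fin (d 3))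
      (((Fin (d 0) × Fin (d 1)) × Fin (d 2)) × Fin (d 3)) ℂ :=
  kroneckerSum
    (kroneckerSum
      (kroneckerSum (nilpotentJordanCell (d 0)) (nilpotentJordanCell (d 1)))
      (nilpotentJordanCell (d 2)))
    (nilpotentJordanCell (d 3))

/-- The direct sum over `D = 1, …, K` of `m D` copies of the nilpotent Jordan cell of size `D`. -/
def jordanDirectSum (K : ℕ) (m : ℕ → ℕ) :
    Matrix (Σ p : (Σ D : Finset.Icc 1 K, Fin (m D)), Fin p.1)
      (Σ p : (Σ D : Finset.Icc 1 K, Fin (m D)), Fin p.1) ℂ :=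
  Matrix.blockDiagonal' fun p : (Σ D : Finset.Icc 1 K, Fin (m D)) => nilpotentJordanCell p.1

/-- Similarity of two complex square matrices, whose index types may differ: `A = O B O⁻¹` for an
invertible `O`. -/
def IsSimilar {m n : Type*} [Fintype m] [Fintype n] [DecidableEq m] [DecidableEq n]
    (A : Matrix m m ℂ) (B : Matrix n n ℂ) : Prop :=
  ∃ (O : Matrix m n ℂ) (O' : Matrix n m ℂ), O * O' = 1 ∧ O' * O = 1 ∧ A = O * B * O'

/-- The function `sin (D φ) ∏ sin (d_α φ) / sin³ φ`. -/
noncomputable def characterIntegrand (d : Fin 4 → ℕ) (D : ℕ) (φ : ℝ) : ℝ :=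
  Real.sin (D * φ) * (∏ α, Real.sin (d α * φ)) / Real.sin φ ^ 3

/-- The number `C^D_d = (1/π) ∫_0^{2π} sin (D φ) ∏ sin (d_α φ) / sin³ φ dφ`. -/
noncomputable def characterIntegral (d : Fin 4 → ℕ) (D : ℕ) : ℝ :=
  1 / Real.pi * ∫ φ in (0 : ℝ)..(2 * Real.pi), characterIntegrand d D φ

/-- The group `SU(2)`. -/
abbrev SU2 : Type := Matrix.specialUnitaryGroup (Fin 2) ℂ

/-- The action of `SU(2)` on `ℂ[X₀, X₁]` by linear substitutions of the variables,
`X_i ↦ ∑ j, g j i X_j`. -/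
noncomputable def su2Poly : Representation ℂ SU2 (MvPolynomial (Fin 2) ℂ) where
  toFun g := (MvPolynomial.aeval fun i =>
    ∑ j, MvPolynomial.C ((g : Matrix (Fin 2) (Fin 2) ℂ) j i) * MvPolynomial.X j).toLinearMap
  map_one' := by
    have h : (MvPolynomial.aeval fun i : Fin 2 => ∑ j, MvPolynomial.C
        (((1 : SU2) : Matrix (Fin 2) (Fin 2) ℂ) j i) * MvPolynomial.X j) =
        AlgHom.id ℂ (MvPolynomial (Fin 2) ℂ) := by
      refine MvPolynomial.algHom_ext fun i => ?_
      fin_cases i <;> simp [Fin.sum_univ_two]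
    rw [h]
    rfl
  map_mul' g h := by
    have e : (MvPolynomial.aeval fun i : Fin 2 => ∑ j, MvPolynomial.C
        (((g * h : SU2) : Matrix (Fin 2) (Fin 2) ℂ) j i) * MvPolynomial.X j) =
        (MvPolynomial.aeval fun i : Fin 2 => ∑ j, MvPolynomial.C
          ((g : Matrix (Fin 2) (Fin 2) ℂ) j i) * MvPolynomial.X j).comp
        (MvPolynomial.aeval fun i : Fin 2 => ∑ j, MvPolynomial.C
          ((h : Matrix (Fin 2) (Fin 2) ℂ) j i) * (MvPolynomial.X j : MvPolynomial (Fin 2) ℂ)) := by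
      refine MvPolynomial.algHom_ext fun i => ?_
      simp [Fin.sum_univ_two, Matrix.mul_apply, MvPolynomial.algHom_C]
      ring
    rw [e]
    rfl

/-- The subrepresentation of homogeneous polynomials of degree `n`. -/
noncomputable def su2HomogeneousPoly (n : ℕ) : Subrepresentation su2Poly where
  toSubmodule := MvPolynomial.homogeneousSubmodule (Fin 2) ℂ n
  apply_mem_toSubmodule g p hp := by
    rw [MvPolynomial.mem_homogeneousSubmodule] at hp ⊢
    have h := hp.aeval (n := 1) (fun i => ∑ j, MvPolynomial.C
      ((g : Matrix (Fin 2) (Fin 2) ℂ) j i) * (MvPolynomial.X j : MvPolynomial (Fin 2) ℂ))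
      (fun i => MvPolynomial.IsHomogeneous.sum _ _ _ fun j _ =>
        (MvPolynomial.isHomogeneous_X ℂ j).C_mul _)
    rw [one_mul] at h
    exact h

/-- The irreducible representation of `SU(2)` of dimension `d ≥ 1`, realized on the homogeneous
polynomials of degree `d - 1` in two variables. -/
noncomputable def su2Irrep (d : ℕ) :
    Representation ℂ SU2 (su2HomogeneousPoly (d - 1)).toSubmodule :=
  (su2HomogeneousPoly (d - 1)).toRepresentation

/-- The Clebsch–Gordan multiplicity: the multiplicity of the irreducible representation of
dimension `D` in the tensor product of those of dimensions `d 0, d 1, d 2, d 3`, i.e. the dimension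
of the space of intertwining maps. -/
noncomputable def clebschGordanMultiplicity (d : Fin 4 → ℕ) (D : ℕ) : ℕ :=
  Module.finrank ℂ (Representation.IntertwiningMap (su2Irrep D)
    ((((su2Irrep (d 0)).tprod (su2Irrep (d 1))).tprod (su2Irrep (d 2))).tprod (su2Irrep (d 3))))

/-! The tensor product `V` of the four irreducible representations carries an action of `sl₂` with
basis `E, F, H`. In the basis of divided power monomials `F` acts on each factor exactly as a Jordan
cell, so on `V` its matrix is the Kronecker sum (`toMatrix_tensorAction`). The claim is thus about
the Jordan form of `F`: its chains are the strings `v, F v, F² v, …` starting at primitive vectors,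
and a primitive vector of weight `D - 1` starts a chain of length `D`
(`exists_basis_toMatrix_lower`). Hence the multiplicity of `J_D` is the dimension of the space of
primitive vectors of weight `D - 1`.

This dimension is computed in two ways. `E` maps weight `μ` onto weight `μ + 2` for `μ ≥ -1`, so the
dimension is the number of weights equal to `D - 1` minus the number equal to `D + 1`; Fourier
orthogonality turns that difference into the integral (`characterIntegral_eq`). On the other hand,
an intertwiner from the irreducible representation of dimension `D` is determined by the image of
the highest weight vector, which can be any primitive vector of weight `D - 1`
(`finrank_intertwiningMap`). The parity statement holds because all weights of `V` have the parity
of `∑ d α`. -/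

section Sl2

/-! ### Finite-dimensional `sl₂` theory: weights, primitive vectors and strings. -/

variable {V : Type*} [AddCommGroup V] [Module ℂ V]

/-- The operators `E, F, H` satisfy the commutation relations of the standard basis of `sl₂`. -/
structure IsSl2Action (E F H : Module.End ℂ V) : Prop where
  ef : ∀ x, E (F x) = F (E x) + H x
  he : ∀ x, H (E x) = E (H x) + (2 : ℂ) • E x
  hf : ∀ x, H (F x) = F (H x) - (2 : ℂ) • F x

/-- The space of primitive (highest weight) vectors of weight `μ`. -/
def primitiveSpace (E H : Module.End ℂ V) (μ : ℤ) : Submodule ℂ V :=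
  LinearMap.ker E ⊓ H.eigenspace (μ : ℂ)

theorem mem_primitiveSpace {E H : Module.End ℂ V} {μ : ℤ} {x : V} :
    x ∈ primitiveSpace E H μ ↔ E x = 0 ∧ H x = (μ : ℂ) • x := by
  simp [primitiveSpace]

namespace IsSl2Action

variable {E F H : Module.End ℂ V}

/-- The Weyl reflection: it transfers results about positive weights to negative ones. -/
theorem symm (h : IsSl2Action E F H) : IsSl2Action F E (-H) where
  ef x := by simp [h.ef]
  he x := by simp [h.hf]; abel
  hf x := by simp [h.he]; abel

theorem eigenspace_neg (H : Module.End ℂ V) (μ : ℤ) :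
    (-H).eigenspace (μ : ℂ) = H.eigenspace ((-μ : ℤ) : ℂ) := by
  ext x
  simp only [Module.End.mem_eigenspace_iff, LinearMap.neg_apply, Int.cast_neg, neg_smul]
  exact neg_eq_iff_eq_neg

theorem map_raise (h : IsSl2Action E F H) {μ : ℤ} {x : V} (hx : x ∈ H.eigenspace (μ : ℂ)) :
    E x ∈ H.eigenspace ((μ + 2 : ℤ) : ℂ) := by
  rw [Module.End.mem_eigenspace_iff] at *
  rw [h.he, hx, map_smul, ← add_smul]
  push_cast
  rfl

theorem map_lower (h : IsSl2Action E F H) {μ : ℤ} {x : V} (hx : x ∈ H.eigenspace (μ : ℂ)) :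
    F x ∈ H.eigenspace ((μ - 2 : ℤ) : ℂ) := by
  rw [Module.End.mem_eigenspace_iff] at *
  rw [h.hf, hx, map_smul, ← sub_smul]
  push_cast
  rfl

theorem map_raise_pow (h : IsSl2Action E F H) {μ : ℤ} {x : V} (hx : x ∈ H.eigenspace (μ : ℂ))
    (k : ℕ) : (E ^ k) x ∈ H.eigenspace ((μ + 2 * k : ℤ) : ℂ) := by
  induction k with
  | zero => simpa using hx
  | succ k ih =>
    rw [pow_succ', Module.End.mul_apply]
    have := h.map_raise ih
    convert this using 2
    push_cast
    ring

theorem map_lower_pow (h : IsSl2Action E F H) {μ : ℤ} {x : V} (hx : x ∈ H.eigenspace (μ : ℂ))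
    (k : ℕ) : (F ^ k) x ∈ H.eigenspace ((μ - 2 * k : ℤ) : ℂ) := by
  induction k with
  | zero => simpa using hx
  | succ k ih =>
    rw [pow_succ', Module.End.mul_apply]
    have := h.map_lower ih
    convert this using 2
    push_cast
    ring

theorem exists_weight_bound [FiniteDimensional ℂ V] (H : Module.End ℂ V) :
    ∃ M : ℤ, ∀ μ : ℤ, M < μ → H.eigenspace (μ : ℂ) = ⊥ := by
  have hfin : Set.Finite {μ : ℤ | H.HasEigenvalue (μ : ℂ)} :=
    H.finite_hasEigenvalue.preimage Int.cast_injective.injOn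
  obtain ⟨M, hM⟩ := hfin.bddAbove
  refine ⟨M, fun μ hμ => ?_⟩
  by_contra hne
  exact absurd (hM (show H.HasEigenvalue (μ : ℂ) from hne)) (not_le.mpr hμ)

theorem exists_raise_pow_eq_zero [FiniteDimensional ℂ V] (h : IsSl2Action E F H) {μ : ℤ} {x : V}
    (hx : x ∈ H.eigenspace (μ : ℂ)) : ∃ k : ℕ, (E ^ k) x = 0 := by
  obtain ⟨M, hM⟩ := exists_weight_bound H
  refine ⟨(M + 1 - μ).toNat, ?_⟩
  have h1 := h.map_raise_pow hx (M + 1 - μ).toNat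
  rw [hM _ (by omega)] at h1
  simpa using h1

/-- Going up the string, `E F` acts on `E ^ k x` by `-c` with `c ≥ 0`, where `c` grows by the weight
`μ + 2k` at each step. If `E ^ (k + 1) x = 0`, the commutation relation makes `E F` act by `μ + 2k >
0` instead, so `E ^ k x = 0` already. A nonzero `x` would therefore have no vanishing `E ^ k x`,
which finite dimension forbids. -/
theorem eq_zero_of_raise_lower_eq_zero [FiniteDimensional ℂ V] (h : IsSl2Action E F H) {μ : ℤ}
    (hμ : 1 ≤ μ) {x : V} (hx : x ∈ H.eigenspace (μ : ℂ)) (h0 : E (F x) = 0) : x = 0 := by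
  have key : ∀ k : ℕ, ∃ c : ℝ, 0 ≤ c ∧ E (F ((E ^ k) x)) = -(c : ℂ) • (E ^ k) x := by
    intro k
    induction k with
    | zero => exact ⟨0, le_rfl, by simpa using h0⟩
    | succ k ih =>
      obtain ⟨c, hc, hk⟩ := ih
      have hw := h.map_raise_pow hx k
      rw [Module.End.mem_eigenspace_iff] at hw
      have hFE : F (E ((E ^ k) x)) = -((c + (μ + 2 * k) : ℝ) : ℂ) • (E ^ k) x := by
        have := h.ef ((E ^ k) x)
        rw [hk, hw] at this
        rw [eq_sub_of_add_eq this.symm, ← sub_smul]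
        congr 1
        push_cast
        ring
      have hμ' : (1 : ℝ) ≤ μ := by exact_mod_cast hμ
      refine ⟨c + (μ + 2 * k), by positivity, ?_⟩
      rw [pow_succ', Module.End.mul_apply, hFE, map_smul]
  by_contra hne
  have hnz : ∀ k : ℕ, (E ^ k) x ≠ 0 := by
    intro k
    induction k with
    | zero => simpa using hne
    | succ k ih =>
      intro h1
      rw [pow_succ', Module.End.mul_apply] at h1
      obtain ⟨c, hc, hk⟩ := key k
      have hw := h.map_raise_pow hx k
      rw [Module.End.mem_eigenspace_iff] at hw
      have := h.ef ((E ^ k) x)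
      rw [hk, hw, h1, map_zero, zero_add, ← sub_eq_zero, ← sub_smul, smul_eq_zero] at this
      rcases this with h2 | h2
      · have h3 : ((c + (μ + 2 * k) : ℝ) : ℂ) = 0 := by
          push_cast at h2 ⊢
          linear_combination -h2
        rw [Complex.ofReal_eq_zero] at h3
        have hμ' : (1 : ℝ) ≤ μ := by exact_mod_cast hμ
        have : (0 : ℝ) ≤ k := k.cast_nonneg
        linarith
      · exact ih h2
  obtain ⟨k, hk⟩ := h.exists_raise_pow_eq_zero hx
  exact hnz k hk

theorem exists_raise_lower_eq [FiniteDimensional ℂ V] (h : IsSl2Action E F H) {μ : ℤ}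
    (hμ : 1 ≤ μ) {y : V} (hy : y ∈ H.eigenspace (μ : ℂ)) :
    ∃ x ∈ H.eigenspace (μ : ℂ), E (F x) = y := by
  have hmap : ∀ x ∈ H.eigenspace (μ : ℂ), (E * F) x ∈ H.eigenspace (μ : ℂ) := by
    intro x hx
    have := h.map_raise (h.map_lower hx)
    rwa [sub_add_cancel] at this
  have hinj : Function.Injective ((E * F).restrict hmap) := by
    rw [← LinearMap.ker_eq_bot, LinearMap.ker_eq_bot']
    rintro ⟨x, hx⟩ h0
    exact Subtype.ext (h.eq_zero_of_raise_lower_eq_zero hμ hx (congrArg Subtype.val h0))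
  obtain ⟨⟨x, hx⟩, hxy⟩ := LinearMap.injective_iff_surjective.mp hinj ⟨y, hy⟩
  exact ⟨x, hx, congrArg Subtype.val hxy⟩

theorem exists_lower_raise_eq [FiniteDimensional ℂ V] (h : IsSl2Action E F H) {μ : ℤ}
    (hμ : μ ≤ -1) {y : V} (hy : y ∈ H.eigenspace (μ : ℂ)) :
    ∃ x ∈ H.eigenspace (μ : ℂ), F (E x) = y := by
  have := h.symm.exists_raise_lower_eq (μ := -μ) (by omega) (y := y)
    (by rwa [eigenspace_neg, neg_neg])
  simpa only [eigenspace_neg, neg_neg] using this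

/-- Rank-nullity for `E` from weight `μ` to weight `μ + 2`. Since `μ + 2 ≥ 1`, every target vector
has the form `E (F x)`, so the map is onto; its kernel is the primitive space. -/
theorem finrank_primitiveSpace_add [FiniteDimensional ℂ V] (h : IsSl2Action E F H) {μ : ℤ}
    (hμ : -1 ≤ μ) :
    Module.finrank ℂ (primitiveSpace E H μ) +
      Module.finrank ℂ (H.eigenspace ((μ + 2 : ℤ) : ℂ)) =
      Module.finrank ℂ (H.eigenspace (μ : ℂ)) := by
  let T : H.eigenspace (μ : ℂ) →ₗ[ℂ] H.eigenspace ((μ + 2 : ℤ) : ℂ) :=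
    E.restrict fun x hx => h.map_raise hx
  have hsurj : Function.Surjective T := by
    rintro ⟨y, hy⟩
    obtain ⟨x, hx, hxy⟩ := h.exists_raise_lower_eq (by omega) hy
    have hFx := h.map_lower hx
    rw [add_sub_cancel_right] at hFx
    exact ⟨⟨F x, hFx⟩, Subtype.ext hxy⟩
  have h1 := T.finrank_range_add_finrank_ker
  rw [LinearMap.range_eq_top.mpr hsurj, finrank_top] at h1
  have h2 : Module.finrank ℂ (LinearMap.ker T) = Module.finrank ℂ (primitiveSpace E H μ) := by
    have hker : (LinearMap.ker T).map (H.eigenspace (μ : ℂ)).subtype = primitiveSpace E H μ := by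
      ext x
      simp only [Submodule.mem_map, LinearMap.mem_ker, Submodule.subtype_apply, primitiveSpace,
        Submodule.mem_inf]
      constructor
      · rintro ⟨⟨y, hy⟩, hTy, rfl⟩
        exact ⟨congrArg Subtype.val hTy, hy⟩
      · rintro ⟨h1, h2⟩
        exact ⟨⟨x, h2⟩, Subtype.ext h1, rfl⟩
    rw [← hker]
    exact (LinearEquiv.finrank_eq (Submodule.equivSubtypeMap _ _).symm |>.symm)
  omega

theorem primitiveSpace_eq_bot [FiniteDimensional ℂ V] (h : IsSl2Action E F H) {μ : ℤ}
    (hμ : μ < 0) : primitiveSpace E H μ = ⊥ := by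
  rw [eq_bot_iff]
  intro x hx
  have hx' := mem_primitiveSpace.mp hx
  have h2 : x ∈ (-H).eigenspace ((-μ : ℤ) : ℂ) := by
    rw [eigenspace_neg, neg_neg]
    exact hx.2
  have := h.symm.eq_zero_of_raise_lower_eq_zero (μ := -μ) (by omega) h2 (by simp [hx'.1])
  simpa using this

/-- Moving `E` past each `F` contributes one weight, and `μ + (μ - 2) + ⋯ + (μ - 2k) = (k + 1)(μ -
k)`. -/
theorem raise_lower_pow_succ (h : IsSl2Action E F H) {μ : ℤ} {v : V}
    (hv : v ∈ primitiveSpace E H μ) (k : ℕ) :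
    E ((F ^ (k + 1)) v) = ((k + 1) * (μ - k) : ℂ) • (F ^ k) v := by
  have hv' := mem_primitiveSpace.mp hv
  induction k with
  | zero => simp [h.ef, hv'.1, hv'.2]
  | succ k ih =>
    have hw := h.map_lower_pow hv.2 (k + 1)
    rw [Module.End.mem_eigenspace_iff] at hw
    rw [pow_succ' F (k + 1), Module.End.mul_apply, h.ef, ih, hw, map_smul, ← Module.End.mul_apply,
      ← pow_succ', ← add_smul]
    congr 1
    push_cast
    ring

/-- The coefficient `(n + 1)(n - n)` vanishes, so this vector is primitive, of negative weight `-n -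
2`. -/
theorem lower_pow_eq_zero [FiniteDimensional ℂ V] (h : IsSl2Action E F H) {n : ℕ} {v : V}
    (hv : v ∈ primitiveSpace E H n) : (F ^ (n + 1)) v = 0 := by
  have h1 : (F ^ (n + 1)) v ∈ primitiveSpace E H (n - 2 * (n + 1 : ℕ)) := by
    refine ⟨?_, h.map_lower_pow hv.2 (n + 1)⟩
    change E _ = 0
    rw [h.raise_lower_pow_succ hv]
    simp
  rw [h.primitiveSpace_eq_bot (by push_cast; omega)] at h1
  simpa using h1

theorem raise_pow_lower_pow_self (h : IsSl2Action E F H) {μ : ℤ} {v : V}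
    (hv : v ∈ primitiveSpace E H μ) (k : ℕ) :
    (E ^ k) ((F ^ k) v) = (∏ j ∈ Finset.range k, ((j + 1) * (μ - j) : ℂ)) • v := by
  induction k with
  | zero => simp
  | succ k ih =>
    rw [pow_succ E, Module.End.mul_apply, h.raise_lower_pow_succ hv, map_smul, ih,
      Finset.prod_range_succ, smul_smul, mul_comm]

theorem raise_pow_lower_pow_of_lt (h : IsSl2Action E F H) {μ : ℤ} {v : V}
    (hv : v ∈ primitiveSpace E H μ) {k n : ℕ} (hk : k < n) : (E ^ n) ((F ^ k) v) = 0 := by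
  obtain ⟨m, rfl⟩ : ∃ m, n = m + 1 + k := ⟨n - k - 1, by omega⟩
  rw [pow_add, Module.End.mul_apply, h.raise_pow_lower_pow_self hv, map_smul, pow_succ,
    Module.End.mul_apply, (mem_primitiveSpace.mp hv).1]
  simp

theorem linearIndependent_strings (h : IsSl2Action E F H) {P : Type*} [Fintype P] (D : P → ℕ)
    (v : P → V) (hv : ∀ p, v p ∈ primitiveSpace E H ((D p : ℤ) - 1))
    (hli : LinearIndependent ℂ v) :
    LinearIndependent ℂ fun q : Σ p, Fin (D p) => (F ^ (q.2 : ℕ)) (v q.1) := by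
  rw [Fintype.linearIndependent_iff]
  intro c hc
  -- Descending induction on the position `K`; `N` bounds the positions remaining above it. Applying
  -- `E ^ K` to the relation kills the positions below `K`, those above have zero coefficient by
  -- induction, and position `K` returns a nonzero multiple of `v p`.
  have key : ∀ N : ℕ, ∀ K : ℕ, (∀ p, D p ≤ N + K) → ∀ p (i : Fin (D p)), K ≤ i → c ⟨p, i⟩ = 0 := by
    intro N
    induction N with
    | zero =>
      intro K hK p i hi
      have := hK p
      omega
    | succ N ih =>
      intro K hK p i hi
      have ih' := ih (K + 1) (fun p => by have := hK p; omega)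
      rcases hi.lt_or_eq with hlt | heq
      · exact ih' p i hlt
      have h1 := congrArg (E ^ K) hc
      rw [map_zero, map_sum, Fintype.sum_sigma] at h1
      have h2 : ∀ p, ∑ i : Fin (D p), (E ^ K) (c ⟨p, i⟩ • (F ^ (i : ℕ)) (v p)) =
          (if hp : K < D p then c ⟨p, ⟨K, hp⟩⟩ *
            ∏ j ∈ Finset.range K, ((j + 1) * (((D p : ℤ) - 1 : ℤ) - j) : ℂ) else 0) • v p := by
        intro p
        split_ifs with hp
        · rw [Finset.sum_eq_single (⟨K, hp⟩ : Fin (D p))]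
          · rw [map_smul, h.raise_pow_lower_pow_self (hv p), smul_smul]
          · intro j _ hj
            rcases lt_trichotomy (j : ℕ) K with hjK | hjK | hjK
            · rw [map_smul, h.raise_pow_lower_pow_of_lt (hv p) hjK, smul_zero]
            · exact absurd (Fin.ext hjK) hj
            · rw [ih' p j hjK]
              simp
          · simp
        · rw [zero_smul]
          refine Finset.sum_eq_zero fun j _ => ?_
          rw [map_smul, h.raise_pow_lower_pow_of_lt (hv p) (by omega), smul_zero]
      rw [Finset.sum_congr rfl fun p _ => h2 p] at h1
      have h3 := Fintype.linearIndependent_iff.mp hli _ h1 p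
      have hp : K < D p := heq ▸ i.2
      rw [dif_pos hp, mul_eq_zero] at h3
      have hi' : i = ⟨K, hp⟩ := Fin.ext heq.symm
      rw [hi']
      refine h3.resolve_right ?_
      rw [← ne_eq, Finset.prod_ne_zero_iff]
      intro j hj
      have hj' := Finset.mem_range.mp hj
      refine mul_ne_zero (by exact_mod_cast j.succ_ne_zero) ?_
      have : ((D p : ℤ) - 1 - j : ℤ) ≠ 0 := by omega
      exact_mod_cast this
  rintro ⟨p, i⟩
  exact key (∑ p, D p) 0 (fun p => Finset.single_le_sum (f := D) (fun _ _ => Nat.zero_le _)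
    (Finset.mem_univ p)) p i (Nat.zero_le _)

/-- Descending induction on the weight, starting above all weights. A vector of negative weight is
`F (E y)`. For weight `μ ≥ 0`, choose `y` of weight `μ + 2` with `E (F y) = E x`; then `x - F y` is
primitive. -/
theorem eq_top_of_primitiveSpace_le [FiniteDimensional ℂ V] (h : IsSl2Action E F H)
    (htop : ⨆ μ : ℤ, H.eigenspace (μ : ℂ) = ⊤) (S : Submodule ℂ V)
    (hF : ∀ x ∈ S, F x ∈ S) (hS : ∀ n : ℕ, primitiveSpace E H n ≤ S) : S = ⊤ := by
  rw [eq_top_iff, ← htop, iSup_le_iff]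
  obtain ⟨M, hM⟩ := exists_weight_bound H
  have key : ∀ k : ℕ, ∀ μ : ℤ, M < μ + k → H.eigenspace (μ : ℂ) ≤ S := by
    intro k
    induction k with
    | zero =>
      intro μ hμ
      rw [hM μ (by simpa using hμ)]
      exact bot_le
    | succ k ih =>
      intro μ hμ x hx
      have ih' := ih (μ + 2) (by push_cast at hμ; omega)
      by_cases hneg : μ ≤ -1
      · obtain ⟨y, hy, rfl⟩ := h.exists_lower_raise_eq hneg hx
        exact hF _ (ih' (h.map_raise hy))
      · obtain ⟨y, hy, hxy⟩ := h.exists_raise_lower_eq (by omega) (h.map_raise hx)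
        have hFy := h.map_lower hy
        rw [add_sub_cancel_right] at hFy
        have hp : x - F y ∈ primitiveSpace E H μ :=
          ⟨by change E _ = 0; rw [map_sub, hxy, sub_self], Submodule.sub_mem _ hx hFy⟩
        have hp' : x - F y ∈ S := by
          refine hS μ.toNat ?_
          rwa [Int.toNat_of_nonneg (by omega)]
        simpa using S.add_mem hp' (hF _ (ih' hy))
  intro μ
  exact key (M + 1 - μ).toNat μ (by omega)

end IsSl2Action

end Sl2

/-! ### The Jordan form of the lowering operator. -/

section JordanForm

variable {V : Type*} [AddCommGroup V] [Module ℂ V]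

theorem isSimilar_toMatrix {ι κ : Type*} [Fintype ι] [Fintype κ] [DecidableEq ι] [DecidableEq κ]
    (b : Module.Basis ι ℂ V) (c : Module.Basis κ ℂ V) (f : Module.End ℂ V) :
    IsSimilar (LinearMap.toMatrix b b f) (LinearMap.toMatrix c c f) :=
  ⟨b.toMatrix c, c.toMatrix b, b.toMatrix_mul_toMatrix_flip c, c.toMatrix_mul_toMatrix_flip b,
    (basis_toMatrix_mul_linearMap_toMatrix_mul_basis_toMatrix b c b c f).symm⟩

theorem linearIndependent_sigma_of_iSupIndep {ι : Type*} {κ : ι → Type*} [Fintype ι]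
    [∀ i, Fintype (κ i)] {p : ι → Submodule ℂ V} (hp : iSupIndep p)
    (v : ∀ i, κ i → V) (hv : ∀ i k, v i k ∈ p i) (hli : ∀ i, LinearIndependent ℂ (v i)) :
    LinearIndependent ℂ fun q : Σ i, κ i => v q.1 q.2 := by
  rw [Fintype.linearIndependent_iff]
  rintro c hc ⟨i, k⟩
  rw [Fintype.sum_sigma] at hc
  have h1 := (iSupIndep_iff_finsetSum_eq_zero_imp_eq_zero p).mp hp Finset.univ
    (fun i => ∑ k, c ⟨i, k⟩ • v i k)
    (fun i _ => Submodule.sum_mem _ fun k _ => Submodule.smul_mem _ _ (hv i k)) hc i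
    (Finset.mem_univ i)
  exact Fintype.linearIndependent_iff.mp (hli i) _ h1 k

namespace IsSl2Action

variable {E F H : Module.End ℂ V}

theorem exists_basis_toMatrix_lower [FiniteDimensional ℂ V] (h : IsSl2Action E F H)
    (htop : ⨆ μ : ℤ, H.eigenspace (μ : ℂ) = ⊤) (K : ℕ)
    (hK : ∀ μ : ℤ, K ≤ μ → H.eigenspace (μ : ℂ) = ⊥) (m : ℕ → ℕ)
    (hm : ∀ D : ℕ, m D = Module.finrank ℂ (primitiveSpace E H ((D : ℤ) - 1))) :
    ∃ B : Module.Basis (Σ p : (Σ D : Finset.Icc 1 K, Fin (m D)), Fin p.1) ℂ V,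
      LinearMap.toMatrix B B F = jordanDirectSum K m := by
  let P := Σ D : Finset.Icc 1 K, Fin (m D)
  let bas : ∀ D : ℕ, Module.Basis (Fin (m D)) ℂ (primitiveSpace E H ((D : ℤ) - 1)) := fun D =>
    Module.finBasisOfFinrankEq ℂ _ (hm D).symm
  let v : P → V := fun p => (bas p.1 p.2 : V)
  have hv : ∀ p : P, v p ∈ primitiveSpace E H (((p.1 : ℕ) : ℤ) - 1) := fun p => (bas p.1 p.2).2
  have hvli : LinearIndependent ℂ v := by
    refine linearIndependent_sigma_of_iSupIndep
      (p := fun D : Finset.Icc 1 K => H.eigenspace (((D : ℕ) - 1 : ℤ) : ℂ))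
      (H.eigenspaces_iSupIndep.comp ?_) (fun D k => (bas D k : V)) (fun D k => (bas D k).2.2) ?_
    · intro D D' hD
      have : (((D : ℕ) : ℤ) - 1) = (((D' : ℕ) : ℤ) - 1) :=
        (Int.cast_inj (α := ℂ)).mp hD
      exact Subtype.ext (by omega)
    · intro D
      exact (bas D).linearIndependent.map' (Submodule.subtype _) (Submodule.ker_subtype _)
  -- Each string is listed backwards, so that `F` lowers the index by one and its ones lie above the
  -- diagonal.
  let e : (Σ p : P, Fin p.1) ≃ (Σ p : P, Fin p.1) := Equiv.sigmaCongrRight fun _ => Fin.revPerm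
  have hli := h.linearIndependent_strings (fun p : P => (p.1 : ℕ)) v hv hvli
  have hzero : ∀ p : P, ∀ k : ℕ, (p.1 : ℕ) ≤ k → (F ^ k) (v p) = 0 := by
    intro p k hk
    obtain ⟨n, hn⟩ : ∃ n, (p.1 : ℕ) = n + 1 :=
      ⟨(p.1 : ℕ) - 1, by have := (Finset.mem_Icc.mp p.1.2).1; omega⟩
    have h1 := hv p
    have h2 : (((p.1 : ℕ) : ℤ) - 1) = (n : ℤ) := by omega
    rw [h2] at h1
    obtain ⟨j, rfl⟩ : ∃ j, k = j + (n + 1) := ⟨k - (n + 1), by omega⟩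
    rw [pow_add, Module.End.mul_apply, h.lower_pow_eq_zero h1, map_zero]
  have hspan : Submodule.span ℂ (Set.range fun q : Σ p : P, Fin p.1 => (F ^ (q.2 : ℕ)) (v q.1)) =
      ⊤ := by
    have hmem : ∀ p : P, ∀ k : ℕ, (F ^ k) (v p) ∈
        Submodule.span ℂ (Set.range fun q : Σ p : P, Fin p.1 => (F ^ (q.2 : ℕ)) (v q.1)) := by
      intro p k
      by_cases hk : k < (p.1 : ℕ)
      · exact Submodule.subset_span ⟨⟨p, ⟨k, hk⟩⟩, rfl⟩
      · rw [hzero p k (not_lt.mp hk)]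
        exact Submodule.zero_mem _
    refine h.eq_top_of_primitiveSpace_le htop _ ?_ ?_
    · intro x hx
      suffices hle : Submodule.span ℂ (Set.range fun q : Σ p : P, Fin p.1 =>
          (F ^ (q.2 : ℕ)) (v q.1)) ≤ Submodule.comap F (Submodule.span ℂ
            (Set.range fun q : Σ p : P, Fin p.1 => (F ^ (q.2 : ℕ)) (v q.1))) from hle hx
      rw [Submodule.span_le]
      rintro _ ⟨⟨p, i⟩, rfl⟩
      have := hmem p (i + 1)
      rwa [pow_succ', Module.End.mul_apply] at this
    · intro n x hx
      -- Primitive vectors of weight `n` start strings of length `n + 1`; there are none with `n ≥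
      -- K`, so lengths up to `K` suffice.
      by_cases hn : n < K
      · let D : Finset.Icc 1 K := ⟨n + 1, Finset.mem_Icc.mpr ⟨by omega, by omega⟩⟩
        have hx' : x ∈ primitiveSpace E H (((D : ℕ) : ℤ) - 1) := by
          simpa [D] using hx
        have h1 := congrArg Subtype.val ((bas D).sum_repr ⟨x, hx'⟩)
        rw [← show _ = x from h1, Submodule.coe_sum]
        exact Submodule.sum_mem _ fun k _ => Submodule.smul_mem _ _ (hmem ⟨D, k⟩ 0)
      · have h0 := hx.2
        rw [hK n (by omega)] at h0
        rw [(Submodule.mem_bot ℂ).mp h0]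
        exact Submodule.zero_mem _
  let B := (Module.Basis.mk hli hspan.ge).reindex e
  have hB : ∀ p : P, ∀ i : Fin p.1, B ⟨p, i⟩ = (F ^ (i.rev : ℕ)) (v p) := by
    intro p i
    rw [Module.Basis.reindex_apply, Module.Basis.mk_apply]
    rfl
  refine ⟨B, ?_⟩
  ext ⟨p, i⟩ ⟨q, j⟩
  rw [LinearMap.toMatrix_apply, hB, ← Module.End.mul_apply, ← pow_succ']
  have hFB : (F ^ ((j.rev : ℕ) + 1)) (v q) =
      if hj : (j : ℕ) = 0 then 0 else B ⟨q, ⟨j - 1, by omega⟩⟩ := by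
    split_ifs with hj
    · refine hzero q _ ?_
      rw [Fin.val_rev]
      omega
    · rw [hB]
      congr 2
      simp only [Fin.val_rev]
      omega
  rw [hFB, jordanDirectSum, Matrix.blockDiagonal'_apply]
  by_cases hpq : p = q
  · subst hpq
    simp only [dite_true, nilpotentJordanCell, Matrix.of_apply, cast_eq]
    split_ifs with h1 h2 h2
    · omega
    · simp
    · rw [Module.Basis.repr_self, Finsupp.single_apply, if_pos]
      congr 1
      exact Fin.ext (by simp; omega)
    · rw [Module.Basis.repr_self, Finsupp.single_apply, if_neg]
      intro h3
      have h4 := congrArg Fin.val (eq_of_heq (Sigma.mk.inj_iff.mp h3).2)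
      simp at h4
      omega
  · rw [dif_neg hpq]
    split_ifs with h1
    · simp
    · rw [Module.Basis.repr_self, Finsupp.single_apply, if_neg]
      intro h3
      exact hpq (Sigma.mk.inj_iff.mp h3).1.symm

end IsSl2Action

end JordanForm

/-! ### Weight counting and the character integral. -/

section Weights

/-- The weights of the irreducible representation of dimension `d`. -/
def irrepWeight (d : ℕ) (i : Fin d) : ℤ := 2 * i - (d - 1)

/-- The weights of a tensor product. -/
def addWeight {ι κ : Type*} (w : ι → ℤ) (w' : κ → ℤ) (p : ι × κ) : ℤ := w p.1 + w' p.2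

/-- The weights of the tensor product of four irreducible representations. -/
abbrev tensorWeight (d : Fin 4 → ℕ) :
    ((Fin (d 0) × Fin (d 1)) × Fin (d 2)) × Fin (d 3) → ℤ :=
  addWeight (addWeight (addWeight (irrepWeight (d 0)) (irrepWeight (d 1))) (irrepWeight (d 2)))
    (irrepWeight (d 3))

/-- The number of indices of weight `μ`. -/
def weightCount {ι : Type*} [Fintype ι] (w : ι → ℤ) (μ : ℤ) : ℕ :=
  (Finset.univ.filter (w · = μ)).card

theorem irrepWeight_rev (d : ℕ) (i : Fin d) : irrepWeight d i.rev = -irrepWeight d i := by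
  simp only [irrepWeight, Fin.val_rev]
  omega

/-- Reversing all four indices negates the weight. -/
theorem weightCount_tensorWeight_neg (d : Fin 4 → ℕ) (μ : ℤ) :
    weightCount (tensorWeight d) (-μ) = weightCount (tensorWeight d) μ := by
  refine Finset.card_equiv (((Fin.revPerm.prodCongr Fin.revPerm).prodCongr
    Fin.revPerm).prodCongr Fin.revPerm) ?_
  intro i
  simp only [Finset.mem_filter, Finset.mem_univ, true_and, addWeight, Equiv.prodCongr_apply,
    Prod.map_fst, Prod.map_snd, Fin.revPerm_apply, irrepWeight_rev]
  omega

/-- The top weight is `∑ d α - 4`. The existence of the index `i` forces every `d α ≥ 1`, so the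
subtraction in `ℕ` does not truncate. -/
theorem tensorWeight_lt (d : Fin 4 → ℕ)
    (i : ((Fin (d 0) × Fin (d 1)) × Fin (d 2)) × Fin (d 3)) :
    tensorWeight d i < ((∑ α, d α) - 3 : ℕ) := by
  have := i.1.1.1.2
  have := i.1.1.2.2
  have := i.1.2.2
  have := i.2.2
  simp only [addWeight, irrepWeight, Fin.sum_univ_four]
  omega

/-- The character formula for `SU(2)`: multiplied by `sin φ`, the geometric sum of exponentials
telescopes. Keeping `sin φ` as a factor avoids dividing by it. -/
theorem sin_nat_mul_eq (d : ℕ) (φ : ℝ) :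
    Complex.sin (d * φ) = Complex.sin φ *
      ∑ i : Fin d, Complex.exp ((irrepWeight d i : ℂ) * φ * Complex.I) := by
  let f : ℕ → ℂ := fun j => Complex.exp (((2 * j - d : ℤ) : ℂ) * φ * Complex.I)
  have h1 : ∀ i : Fin d, Complex.sin φ *
      Complex.exp ((irrepWeight d i : ℂ) * φ * Complex.I) =
      (f (i + 1) - f i) * (-Complex.I / 2) := by
    intro i
    have e1 : f (i + 1) = Complex.exp ((irrepWeight d i : ℂ) * φ * Complex.I) *
        Complex.exp (φ * Complex.I) := by
      rw [← Complex.exp_add]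
      simp only [f, irrepWeight]
      congr 1
      push_cast
      ring
    have e2 : f i = Complex.exp ((irrepWeight d i : ℂ) * φ * Complex.I) *
        Complex.exp (-φ * Complex.I) := by
      rw [← Complex.exp_add]
      simp only [f, irrepWeight]
      congr 1
      push_cast
      ring
    rw [e1, e2, Complex.sin]
    ring
  rw [Finset.mul_sum, Finset.sum_congr rfl fun i _ => h1 i, ← Finset.sum_mul,
    Fin.sum_univ_eq_sum_range (fun j => f (j + 1) - f j), Finset.sum_range_sub, Complex.sin]
  have e1 : f d = Complex.exp (d * φ * Complex.I) := by
    simp only [f]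
    congr 1
    push_cast
    ring
  have e2 : f 0 = Complex.exp (-(d * φ) * Complex.I) := by
    simp only [f]
    congr 1
    push_cast
    ring
  rw [e1, e2]
  ring

theorem sum_exp_mul_sum_exp {ι κ : Type*} [Fintype ι] [Fintype κ] (w : ι → ℤ) (w' : κ → ℤ)
    (z : ℂ) : (∑ i, Complex.exp (w i * z)) * (∑ k, Complex.exp (w' k * z)) =
      ∑ p, Complex.exp (addWeight w w' p * z) := by
  rw [Finset.sum_mul_sum, Fintype.sum_prod_type]
  refine Finset.sum_congr rfl fun i _ => Finset.sum_congr rfl fun k _ => ?_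
  rw [← Complex.exp_add]
  simp only [addWeight]
  push_cast
  ring_nf

theorem prod_sin_eq (d : Fin 4 → ℕ) (φ : ℝ) :
    ∏ α, Real.sin (d α * φ) = Real.sin φ ^ 4 * ∑ i, Real.cos (tensorWeight d i * φ) := by
  have h : ∏ α, Complex.sin (d α * φ) = Complex.sin φ ^ 4 *
      ∑ i, Complex.exp (tensorWeight d i * (φ * Complex.I)) := by
    rw [← sum_exp_mul_sum_exp, ← sum_exp_mul_sum_exp, ← sum_exp_mul_sum_exp, Fin.prod_univ_four]
    simp only [sin_nat_mul_eq, mul_assoc]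
    ring
  have h2 := congrArg Complex.re h
  have e1 : ∏ α, Complex.sin (d α * φ) = ((∏ α, Real.sin (d α * φ) : ℝ) : ℂ) := by
    push_cast
    rfl
  have e2 : Complex.sin φ ^ 4 = ((Real.sin φ ^ 4 : ℝ) : ℂ) := by
    push_cast
    rfl
  rw [e1, e2, Complex.ofReal_re, Complex.re_ofReal_mul, Complex.re_sum] at h2
  rw [h2]
  congr 1
  refine Finset.sum_congr rfl fun i _ => ?_
  have e3 : (tensorWeight d i * (φ * Complex.I) : ℂ) =
      ((tensorWeight d i * φ : ℝ) : ℂ) * Complex.I := by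
    push_cast
    ring
  rw [e3, Complex.exp_ofReal_mul_I_re]

theorem characterIntegrand_eq (d : Fin 4 → ℕ) (D : ℕ) (φ : ℝ) :
    characterIntegrand d D φ =
      ∑ i, Real.sin (D * φ) * Real.sin φ * Real.cos (tensorWeight d i * φ) := by
  rw [characterIntegrand, prod_sin_eq, ← Finset.mul_sum]
  by_cases h : Real.sin φ = 0
  -- At zeros of `sin` the quotient is `0` by the convention for division, and the right side has a
  -- factor `sin φ`; the identity thus holds at every point and exhibits a continuous integrand.
  · simp [h]
  · field_simp

theorem intervalIntegrable_characterIntegrand (d : Fin 4 → ℕ) (D : ℕ) (a b : ℝ) :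
    IntervalIntegrable (characterIntegrand d D) MeasureTheory.volume a b := by
  rw [funext (characterIntegrand_eq d D)]
  exact Continuous.intervalIntegrable (by fun_prop) _ _

theorem integral_cos_int_mul (n : ℤ) :
    ∫ φ in (0 : ℝ)..(2 * Real.pi), Real.cos (n * φ) = if n = 0 then 2 * Real.pi else 0 := by
  split_ifs with h
  · simp [h]
  · have h' : (n : ℝ) ≠ 0 := by exact_mod_cast h
    rw [intervalIntegral.integral_comp_mul_left (fun x => Real.cos x) h', integral_cos]
    have : Real.sin (n * (2 * Real.pi)) = 0 := by
      rw [show (n : ℝ) * (2 * Real.pi) = ((2 * n : ℤ) : ℝ) * Real.pi by push_cast; ring]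
      exact Real.sin_int_mul_pi _
    simp [this]

/-- The product is a quarter of a signed sum of four cosines with integer frequencies `w ∓ (D - 1)`
and `w ∓ (D + 1)`; only frequency zero contributes, namely `2π`. -/
theorem integral_sin_sin_cos (D : ℕ) (w : ℤ) :
    ∫ φ in (0 : ℝ)..(2 * Real.pi), Real.sin (D * φ) * Real.sin φ * Real.cos (w * φ) =
      Real.pi / 2 * ((if w = D - 1 then 1 else 0) + (if w = -(D - 1) then 1 else 0) -
        (if w = D + 1 then 1 else 0) - (if w = -(D + 1) then 1 else 0)) := by
  have h : ∀ φ : ℝ, Real.sin (D * φ) * Real.sin φ * Real.cos (w * φ) =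
      1 / 4 * (Real.cos ((w - (D - 1) : ℤ) * φ) + Real.cos ((w + (D - 1) : ℤ) * φ) -
        Real.cos ((w - (D + 1) : ℤ) * φ) - Real.cos ((w + (D + 1) : ℤ) * φ)) := by
    intro φ
    have e : ∀ x y z : ℝ, Real.sin x * Real.sin y * Real.cos z =
        1 / 4 * (Real.cos (z - (x - y)) + Real.cos (z + (x - y)) - Real.cos (z - (x + y)) -
          Real.cos (z + (x + y))) := by
      intro x y z
      rw [Real.cos_sub z, Real.cos_add z, Real.cos_sub z, Real.cos_add z, Real.cos_add,
        Real.cos_sub]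
      ring
    rw [e]
    push_cast
    ring_nf
  have hint : ∀ n : ℤ, IntervalIntegrable (fun φ : ℝ => Real.cos (n * φ)) MeasureTheory.volume 0
      (2 * Real.pi) := fun n => Continuous.intervalIntegrable (by fun_prop) _ _
  simp_rw [h]
  rw [intervalIntegral.integral_const_mul,
    intervalIntegral.integral_sub (((hint _).add (hint _)).sub (hint _)) (hint _),
    intervalIntegral.integral_sub ((hint _).add (hint _)) (hint _),
    intervalIntegral.integral_add (hint _) (hint _)]
  simp only [integral_cos_int_mul]
  simp only [sub_eq_zero, add_eq_zero_iff_eq_neg]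
  have : ∀ p : Prop, ∀ [Decidable p], (if p then 2 * Real.pi else 0) =
      2 * Real.pi * (if p then 1 else 0) := by
    intro p _
    split_ifs <;> simp
  simp only [this]
  ring

/-- Summing over all weights gives four counts; the symmetry under negation merges them in pairs,
which cancels the factor `1 / 2`. -/
theorem characterIntegral_eq (d : Fin 4 → ℕ) (D : ℕ) :
    characterIntegral d D = (weightCount (tensorWeight d) (D - 1) : ℝ) -
      weightCount (tensorWeight d) (D + 1) := by
  have hc : ∀ μ : ℤ, ∑ i, (if tensorWeight d i = μ then (1 : ℝ) else 0) =
      weightCount (tensorWeight d) μ := by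
    intro μ
    rw [Finset.sum_boole]
    rfl
  rw [characterIntegral, funext (characterIntegrand_eq d D),
    intervalIntegral.integral_finsetSum fun i _ =>
      Continuous.intervalIntegrable (by fun_prop) _ _]
  simp only [integral_sin_sin_cos]
  rw [← Finset.mul_sum, Finset.sum_sub_distrib, Finset.sum_sub_distrib, Finset.sum_add_distrib,
    hc, hc, hc, hc, weightCount_tensorWeight_neg, weightCount_tensorWeight_neg]
  field_simp
  ring

theorem weightCount_eq_zero_of_odd (d : Fin 4 → ℕ) (μ : ℤ) (h : Odd (μ - ∑ α, (d α : ℤ))) :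
    weightCount (tensorWeight d) μ = 0 := by
  rw [weightCount, Finset.card_eq_zero, Finset.filter_eq_empty_iff]
  rintro i - rfl
  obtain ⟨k, hk⟩ := h
  simp only [addWeight, irrepWeight, Fin.sum_univ_four] at hk
  omega

theorem characterIntegral_eq_zero_of_even (d : Fin 4 → ℕ) (D : ℕ)
    (h : Even ((D : ℤ) - ∑ α, (d α : ℤ))) : characterIntegral d D = 0 := by
  obtain ⟨k, hk⟩ := h
  rw [characterIntegral_eq, weightCount_eq_zero_of_odd d _ ⟨k - 1, by omega⟩,
    weightCount_eq_zero_of_odd d _ ⟨k, by omega⟩, sub_self]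

end Weights

/-! ### Passing between `SU(2)` and its Lie algebra without differentiation. -/

section SU2Action

open scoped TensorProduct

/-- The diagonal element `diag (z, z⁻¹)` of `SU(2)`. -/
noncomputable def su2Torus (z : Circle) : SU2 :=
  ⟨!![(z : ℂ), 0; 0, (z : ℂ)⁻¹], by
    have h : (starRingEnd ℂ) (z : ℂ) = (z : ℂ)⁻¹ := by rw [← Circle.coe_inv_eq_conj, Circle.coe_inv]
    rw [Matrix.mem_specialUnitaryGroup_iff, Matrix.mem_unitaryGroup_iff]
    refine ⟨?_, by simp [Matrix.det_fin_two]⟩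
    ext i j
    fin_cases i <;> fin_cases j <;> simp [Matrix.mul_apply, h, Matrix.star_apply]⟩

/-- The element of `SU(2)` with first column `(x, y)`. -/
noncomputable def su2OfColumn (x y : ℂ) (h : x * star x + y * star y = 1) : SU2 :=
  ⟨!![x, -star y; y, star x], by
    rw [Matrix.mem_specialUnitaryGroup_iff, Matrix.mem_unitaryGroup_iff']
    simp only [RCLike.star_def] at h
    refine ⟨?_, ?_⟩
    · ext i j
      fin_cases i <;> fin_cases j <;> simp [Matrix.mul_apply, Matrix.star_apply]
      · linear_combination h
      · ring
      · ring
      · linear_combination h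
    · rw [Matrix.det_fin_two_of]
      simp only [RCLike.star_def]
      linear_combination h⟩

theorem exists_su2Torus_eq_of_lower_left_eq_zero (k : SU2)
    (hk : (k : Matrix (Fin 2) (Fin 2) ℂ) 1 0 = 0) : ∃ z : Circle, k = su2Torus z := by
  obtain ⟨k, hk'⟩ := k
  obtain ⟨hu, hdet⟩ := Matrix.mem_specialUnitaryGroup_iff.mp hk'
  simp only at hk
  have h1 := congrFun (congrFun (Matrix.mem_unitaryGroup_iff'.mp hu) 0) 0
  have h2 := congrFun (congrFun (Matrix.mem_unitaryGroup_iff'.mp hu) 0) 1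
  simp only [Matrix.mul_apply, Fin.sum_univ_two, Matrix.star_apply, hk, mul_zero, add_zero,
    Matrix.one_apply_eq, star_zero, zero_mul] at h1 h2
  rw [Matrix.one_apply_ne (by decide)] at h2
  rw [Matrix.det_fin_two, hk, mul_zero, sub_zero] at hdet
  have hz : ‖k 0 0‖ = 1 := by
    have := congrArg norm h1
    rw [norm_mul, norm_star, norm_one, ← sq] at this
    exact (pow_eq_one_iff_of_nonneg (norm_nonneg _) two_ne_zero).mp this
  refine ⟨⟨k 0 0, mem_sphere_zero_iff_norm.mpr hz⟩, Subtype.ext ?_⟩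
  have h01 : k 0 1 = 0 := by
    refine (mul_eq_zero.mp h2).resolve_left fun h0 => ?_
    rw [h0, zero_mul] at h1
    exact zero_ne_one h1
  ext i j
  fin_cases i <;> fin_cases j <;> simp [su2Torus, hk, h01]
  exact eq_inv_of_mul_eq_one_right hdet

/-- Complete a unit eigenvector of `g` to a matrix `h` in `SU(2)`. Then `h⁻¹ g h` is upper
triangular and unitary, hence diagonal. -/
theorem exists_conj_su2Torus (g : SU2) : ∃ (h : SU2) (z : Circle), g = h * su2Torus z * h⁻¹ := by
  obtain ⟨μ, hμ⟩ := Module.End.exists_eigenvalue (Matrix.toLin' (g : Matrix (Fin 2) (Fin 2) ℂ))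
  obtain ⟨v, hv, hv0⟩ := hμ.exists_hasEigenvector
  rw [Module.End.mem_eigenspace_iff, Matrix.toLin'_apply] at hv
  let n : ℝ := ‖v 0‖ ^ 2 + ‖v 1‖ ^ 2
  have hn : 0 < n := by
    by_contra hle
    have h0 : ‖v 0‖ = 0 := by nlinarith [sq_nonneg ‖v 0‖, sq_nonneg ‖v 1‖]
    have h1 : ‖v 1‖ = 0 := by nlinarith [sq_nonneg ‖v 0‖, sq_nonneg ‖v 1‖]
    apply hv0
    ext i
    fin_cases i
    · simpa using h0
    · simpa using h1
  let r : ℂ := ((Real.sqrt n)⁻¹ : ℝ)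
  have hr : r * r * n = 1 := by
    simp only [r]
    rw [← Complex.ofReal_mul, ← Complex.ofReal_mul, ← mul_inv, Real.mul_self_sqrt hn.le,
      inv_mul_cancel₀ hn.ne', Complex.ofReal_one]
  have hsr : star r = r := Complex.conj_ofReal _
  have hcol : (r * v 0) * star (r * v 0) + (r * v 1) * star (r * v 1) = 1 := by
    have h0 : v 0 * star (v 0) = (‖v 0‖ ^ 2 : ℝ) := by
      rw [RCLike.star_def, Complex.mul_conj, Complex.normSq_eq_norm_sq]
    have h1 : v 1 * star (v 1) = (‖v 1‖ ^ 2 : ℝ) := by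
      rw [RCLike.star_def, Complex.mul_conj, Complex.normSq_eq_norm_sq]
    rw [star_mul', star_mul', hsr, ← hr]
    simp only [n]
    rw [Complex.ofReal_add, ← h0, ← h1]
    ring
  let h : SU2 := su2OfColumn (r * v 0) (r * v 1) hcol
  have hgh0 := congrFun hv 0
  have hgh1 := congrFun hv 1
  simp only [Matrix.mulVec, dotProduct, Fin.sum_univ_two, Pi.smul_apply, smul_eq_mul] at hgh0 hgh1
  -- This entry pairs the second column of `h` with `g` applied to the first, an eigenvector
  -- orthogonal to it.
  have hk : ((h⁻¹ * g * h : SU2) : Matrix (Fin 2) (Fin 2) ℂ) 1 0 = 0 := by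
    have e : ((h⁻¹ * g * h : SU2) : Matrix (Fin 2) (Fin 2) ℂ) =
        star (h : Matrix (Fin 2) (Fin 2) ℂ) * (g * h) := by
      rw [mul_assoc]
      rfl
    rw [e]
    simp only [Matrix.mul_apply, Fin.sum_univ_two, Matrix.star_apply]
    simp only [h, su2OfColumn, Matrix.of_apply, Matrix.cons_val', Matrix.cons_val_zero,
      Matrix.cons_val_one, star_neg, star_star]
    simp
    linear_combination (-(r * v 1) * r) * hgh0 + (r * v 0) * r * hgh1
  obtain ⟨z, hz⟩ := exists_su2Torus_eq_of_lower_left_eq_zero _ hk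
  refine ⟨h, z, ?_⟩
  rw [← hz]
  group

/-- A representation `ρ` of `SU(2)` together with its differential `δ` (extended to all matrices)
and a basis `b` of weight vectors with weights `w`. -/
structure IsSU2Action {V ι : Type*} [AddCommGroup V] [Module ℂ V] (ρ : Representation ℂ SU2 V)
    (δ : Matrix (Fin 2) (Fin 2) ℂ →ₗ[ℂ] Module.End ℂ V) (b : Module.Basis ι ℂ V) (w : ι → ℤ) :
    Prop where
  lie : ∀ A B x, δ (A * B - B * A) x = δ A (δ B x) - δ B (δ A x)
  conj : ∀ (g : SU2) (A B : Matrix (Fin 2) (Fin 2) ℂ), (g : Matrix (Fin 2) (Fin 2) ℂ) * A = B * g →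
    ∀ x, ρ g (δ A x) = δ B (ρ g x)
  weight : ∀ i, δ !![1, 0; 0, -1] (b i) = (w i : ℂ) • b i
  torus : ∀ (z : Circle) i, ρ (su2Torus z) (b i) = (z : ℂ) ^ w i • b i

/-- The action of the Lie algebra on a tensor product. -/
noncomputable def tensorAction {V W : Type*} [AddCommGroup V] [Module ℂ V] [AddCommGroup W]
    [Module ℂ W] (δ : Matrix (Fin 2) (Fin 2) ℂ →ₗ[ℂ] Module.End ℂ V)
    (δ' : Matrix (Fin 2) (Fin 2) ℂ →ₗ[ℂ] Module.End ℂ W) :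
    Matrix (Fin 2) (Fin 2) ℂ →ₗ[ℂ] Module.End ℂ (V ⊗[ℂ] W) :=
  LinearMap.rTensorHom W ∘ₗ δ + LinearMap.lTensorHom V ∘ₗ δ'

section

variable {V W ι κ : Type*} [AddCommGroup V] [Module ℂ V] [AddCommGroup W] [Module ℂ W]

theorem tensorAction_tmul (δ : Matrix (Fin 2) (Fin 2) ℂ →ₗ[ℂ] Module.End ℂ V)
    (δ' : Matrix (Fin 2) (Fin 2) ℂ →ₗ[ℂ] Module.End ℂ W) (A : Matrix (Fin 2) (Fin 2) ℂ)
    (x : V) (y : W) : tensorAction δ δ' A (x ⊗ₜ y) = δ A x ⊗ₜ y + x ⊗ₜ δ' A y := rfl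

theorem toMatrix_tensorAction [Fintype ι] [Fintype κ] [DecidableEq ι] [DecidableEq κ]
    (δ : Matrix (Fin 2) (Fin 2) ℂ →ₗ[ℂ] Module.End ℂ V)
    (δ' : Matrix (Fin 2) (Fin 2) ℂ →ₗ[ℂ] Module.End ℂ W) (b : Module.Basis ι ℂ V)
    (c : Module.Basis κ ℂ W) (A : Matrix (Fin 2) (Fin 2) ℂ) :
    LinearMap.toMatrix (b.tensorProduct c) (b.tensorProduct c) (tensorAction δ δ' A) =
      kroneckerSum (LinearMap.toMatrix b b (δ A)) (LinearMap.toMatrix c c (δ' A)) := by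
  have e : tensorAction δ δ' A = TensorProduct.map (δ A) LinearMap.id +
      TensorProduct.map LinearMap.id (δ' A) := TensorProduct.ext' fun _ _ => rfl
  rw [e, map_add, TensorProduct.toMatrix_map, TensorProduct.toMatrix_map, LinearMap.toMatrix_id,
    LinearMap.toMatrix_id, kroneckerSum]

/-- A linear map intertwines two diagonal operators iff each of its matrix entries does. -/
theorem intertwines_diagonal_iff {b : Module.Basis ι ℂ V} {c : Module.Basis κ ℂ W}
    {α : ι → ℂ} {β : κ → ℂ} {A : Module.End ℂ V} {B : Module.End ℂ W}
    (hA : ∀ i, A (b i) = α i • b i) (hB : ∀ k, B (c k) = β k • c k) (T : V →ₗ[ℂ] W) :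
    (∀ x, T (A x) = B (T x)) ↔
      ∀ i k, α i * c.repr (T (b i)) k = β k * c.repr (T (b i)) k := by
  have hrepr : ∀ y k, c.repr (B y) k = β k * c.repr y k := by
    intro y k
    have : (Finsupp.lapply k) ∘ₗ c.repr.toLinearMap ∘ₗ B =
        β k • ((Finsupp.lapply k) ∘ₗ c.repr.toLinearMap) := by
      refine c.ext fun l => ?_
      by_cases hlk : l = k
      · simp [hB, hlk]
      · simp [hB, hlk]
    exact LinearMap.congr_fun this y
  constructor
  · intro h i k
    rw [← hrepr, ← h, hA, map_smul, map_smul, Finsupp.smul_apply, smul_eq_mul]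
  · intro h
    have : T ∘ₗ A = B ∘ₗ T := by
      refine b.ext fun i => c.repr.injective (Finsupp.ext fun k => ?_)
      rw [LinearMap.comp_apply, LinearMap.comp_apply, hrepr, ← h, hA, map_smul, map_smul,
        Finsupp.smul_apply, smul_eq_mul]
    exact LinearMap.congr_fun this

end

namespace IsSU2Action

variable {V W ι κ : Type*} [AddCommGroup V] [Module ℂ V] [AddCommGroup W] [Module ℂ W]
  {ρ : Representation ℂ SU2 V} {δ : Matrix (Fin 2) (Fin 2) ℂ →ₗ[ℂ] Module.End ℂ V}
  {b : Module.Basis ι ℂ V} {w : ι → ℤ}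
  {ρ' : Representation ℂ SU2 W} {δ' : Matrix (Fin 2) (Fin 2) ℂ →ₗ[ℂ] Module.End ℂ W}
  {c : Module.Basis κ ℂ W} {w' : κ → ℤ}

theorem tprod (h : IsSU2Action ρ δ b w) (h' : IsSU2Action ρ' δ' c w') :
    IsSU2Action (ρ.tprod ρ') (tensorAction δ δ') (b.tensorProduct c) (addWeight w w') where
  lie A B x := by
    induction x with
    | zero => simp
    | add x y hx hy => simp only [map_add, hx, hy]; abel
    | tmul x y =>
      simp only [tensorAction_tmul, map_add, h.lie, h'.lie, TensorProduct.sub_tmul,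
        TensorProduct.tmul_sub]
      abel
  conj g A B hAB x := by
    induction x with
    | zero => simp
    | add x y hx hy => simp only [map_add, hx, hy]
    | tmul x y =>
      simp only [tensorAction_tmul, map_add, Representation.tprod_apply, TensorProduct.map_tmul,
        h.conj g A B hAB, h'.conj g A B hAB]
  weight := by
    rintro ⟨i, k⟩
    rw [Module.Basis.tensorProduct_apply, tensorAction_tmul, h.weight, h'.weight,
      ← TensorProduct.smul_tmul', TensorProduct.tmul_smul, ← add_smul]
    simp [addWeight]
  torus := by
    rintro z ⟨i, k⟩
    rw [Module.Basis.tensorProduct_apply, Representation.tprod_apply, TensorProduct.map_tmul,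
      h.torus, h'.torus, TensorProduct.smul_tmul_smul, addWeight, zpow_add₀ z.coe_ne_zero]

theorem isSl2Action (h : IsSU2Action ρ δ b w) :
    IsSl2Action (δ !![0, 1; 0, 0]) (δ !![0, 0; 1, 0]) (δ !![1, 0; 0, -1]) where
  ef x := by
    have := h.lie !![0, 1; 0, 0] !![0, 0; 1, 0] x
    rw [eq_add_of_sub_eq' this.symm]
    congr 3
    ext i j
    fin_cases i <;> fin_cases j <;> simp
  he x := by
    have := h.lie !![1, 0; 0, -1] !![0, 1; 0, 0] x
    rw [eq_add_of_sub_eq' this.symm, ← LinearMap.smul_apply, ← map_smul]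
    congr 3
    ext i j
    fin_cases i <;> fin_cases j <;> simp
    norm_num
  hf x := by
    have := h.lie !![1, 0; 0, -1] !![0, 0; 1, 0] x
    rw [eq_add_of_sub_eq' this.symm, sub_eq_add_neg (δ _ (δ _ x)), ← LinearMap.smul_apply,
      ← map_smul, ← LinearMap.neg_apply, ← map_neg]
    congr 3
    ext i j
    fin_cases i <;> fin_cases j <;> simp
    norm_num

theorem iSup_eigenspace (h : IsSU2Action ρ δ b w) :
    ⨆ μ : ℤ, (δ !![1, 0; 0, -1]).eigenspace (μ : ℂ) = ⊤ := by
  rw [eq_top_iff, ← b.span_eq, Submodule.span_le]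
  rintro _ ⟨i, rfl⟩
  exact Submodule.mem_iSup_of_mem (w i) (Module.End.mem_eigenspace_iff.mpr (h.weight i))

theorem eigenspace_eq_span (h : IsSU2Action ρ δ b w) (μ : ℤ) :
    (δ !![1, 0; 0, -1]).eigenspace (μ : ℂ) =
      Submodule.span ℂ (Set.range fun i : {i // w i = μ} => b i) := by
  apply le_antisymm
  · intro x hx
    rw [Module.End.mem_eigenspace_iff] at hx
    have hrepr : ∀ i, b.repr x i ≠ 0 → w i = μ := by
      intro i hi
      have h1 : (b.coord i) ∘ₗ (δ !![1, 0; 0, -1]) = (w i : ℂ) • b.coord i := by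
        refine b.ext fun k => ?_
        by_cases hk : k = i
        · simp [h.weight, hk]
        · simp [h.weight, hk]
      have h2 := LinearMap.congr_fun h1 x
      rw [LinearMap.comp_apply, hx, map_smul, LinearMap.smul_apply, Module.Basis.coord_apply,
        smul_eq_mul, smul_eq_mul] at h2
      exact_mod_cast (mul_right_cancel₀ hi h2).symm
    rw [← b.linearCombination_repr x, Finsupp.linearCombination_apply]
    refine Submodule.sum_mem _ fun i hi => Submodule.smul_mem _ _ (Submodule.subset_span ?_)
    exact ⟨⟨i, hrepr i (Finsupp.mem_support_iff.mp hi)⟩, rfl⟩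
  · rw [Submodule.span_le]
    rintro _ ⟨⟨i, rfl⟩, rfl⟩
    exact Module.End.mem_eigenspace_iff.mpr (h.weight i)

theorem finrank_eigenspace [Fintype ι] (h : IsSU2Action ρ δ b w) (μ : ℤ) :
    Module.finrank ℂ ((δ !![1, 0; 0, -1]).eigenspace (μ : ℂ)) = weightCount w μ := by
  classical
  have hli : LinearIndependent ℂ fun i : {i // w i = μ} => b i :=
    b.linearIndependent.comp _ Subtype.val_injective
  rw [h.eigenspace_eq_span, finrank_span_eq_card hli, Fintype.card_subtype]
  rfl

theorem finrank_primitiveSpace_add [Fintype ι] (h : IsSU2Action ρ δ b w) {μ : ℤ} (hμ : -1 ≤ μ) :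
    Module.finrank ℂ (primitiveSpace (δ !![0, 1; 0, 0]) (δ !![1, 0; 0, -1]) μ) +
      weightCount w (μ + 2) = weightCount w μ := by
  have := Module.Basis.finiteDimensional_of_finite b
  rw [← h.finrank_eigenspace, ← h.finrank_eigenspace]
  exact h.isSl2Action.finrank_primitiveSpace_add hμ

theorem isSimilar_jordanDirectSum [Fintype ι] [DecidableEq ι] (h : IsSU2Action ρ δ b w) (K : ℕ)
    (hK : ∀ i, w i < K) :
    IsSimilar (LinearMap.toMatrix b b (δ !![0, 0; 1, 0])) (jordanDirectSum K fun D =>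
      Module.finrank ℂ (primitiveSpace (δ !![0, 1; 0, 0]) (δ !![1, 0; 0, -1]) ((D : ℤ) - 1))) := by
  have := Module.Basis.finiteDimensional_of_finite b
  obtain ⟨B, hB⟩ := h.isSl2Action.exists_basis_toMatrix_lower h.iSup_eigenspace K (fun μ hμ => by
    rw [← Submodule.finrank_eq_zero, h.finrank_eigenspace, weightCount, Finset.card_eq_zero,
      Finset.filter_eq_empty_iff]
    intro i _ hi
    have := hK i
    omega) _ (fun _ => rfl)
  rw [← hB]
  exact isSimilar_toMatrix b B _

/-- Any trace zero matrix is a combination of the standard basis of `sl₂`. -/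
theorem apply_eq_of_trace_eq_zero (δ : Matrix (Fin 2) (Fin 2) ℂ →ₗ[ℂ] Module.End ℂ V)
    {A : Matrix (Fin 2) (Fin 2) ℂ} (hA : A.trace = 0) :
    δ A = A 0 0 • δ !![1, 0; 0, -1] + A 0 1 • δ !![0, 1; 0, 0] + A 1 0 • δ !![0, 0; 1, 0] := by
  have e : A = A 0 0 • !![1, 0; 0, -1] + A 0 1 • !![0, 1; 0, 0] + A 1 0 • !![0, 0; 1, 0] := by
    rw [Matrix.trace_fin_two] at hA
    ext i j
    fin_cases i <;> fin_cases j <;> simp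
    linear_combination hA
  conv_lhs => rw [e]
  simp only [map_add, map_smul]

/-- Commuting with the torus forces `T` to preserve weights, and preserving weights is commuting
with `H`. -/
theorem map_cartan_apply (h : IsSU2Action ρ δ b w) (h' : IsSU2Action ρ' δ' c w')
    {T : V →ₗ[ℂ] W} (hT : ∀ g x, T (ρ g x) = ρ' g (T x)) (x : V) :
    T (δ !![1, 0; 0, -1] x) = δ' !![1, 0; 0, -1] (T x) := by
  revert x
  rw [intertwines_diagonal_iff h.weight h'.weight]
  intro i k
  by_cases hik : w i = w' k
  · rw [hik]
  have hn : ((w i - w' k : ℤ) : ℂ) ≠ 0 := by exact_mod_cast sub_ne_zero.mpr hik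
  -- A torus element separating the two weights: its powers `w i` and `w' k` differ by the factor
  -- `-1`.
  let z : Circle := Circle.exp (Real.pi / (w i - w' k : ℤ))
  have hz : (z : ℂ) ^ (w i - w' k) = -1 := by
    rw [Circle.coe_exp, ← Complex.exp_int_mul, ← Complex.exp_pi_mul_I]
    congr 1
    push_cast at hn ⊢
    field_simp
  have h1 := (intertwines_diagonal_iff (h.torus z) (h'.torus z) T).mp (hT _) i k
  have h2 : c.repr (T (b i)) k = 0 := by
    by_contra hne
    have h3 := mul_right_cancel₀ hne h1
    rw [zpow_sub₀ z.coe_ne_zero, h3, div_self (zpow_ne_zero _ z.coe_ne_zero)] at hz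
    norm_num at hz
  rw [h2, mul_zero, mul_zero]

theorem map_apply_of_conj (h : IsSU2Action ρ δ b w) (h' : IsSU2Action ρ' δ' c w')
    {T : V →ₗ[ℂ] W} {g : SU2} (hT : ∀ g x, T (ρ g x) = ρ' g (T x))
    {A B : Matrix (Fin 2) (Fin 2) ℂ} (hAB : (g : Matrix (Fin 2) (Fin 2) ℂ) * A = B * g)
    (hA : ∀ x, T (δ A x) = δ' A (T x)) (x : V) : T (δ B x) = δ' B (T x) := by
  have h1 := h.conj g A B hAB (ρ g⁻¹ x)
  have h2 := h'.conj g A B hAB (ρ' g⁻¹ (T x))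
  rw [Representation.self_inv_apply] at h1 h2
  rw [← h1, ← h2, hT, hA, hT]

/-- The torus gives the relation for `H`. Conjugating `H` by the rotation through `π / 4` gives `E +
F`, and the commutator of these two is `2 (E - F)`. The three matrices span the trace zero matrices.
-/
theorem map_apply_of_intertwines (h : IsSU2Action ρ δ b w) (h' : IsSU2Action ρ' δ' c w')
    {T : V →ₗ[ℂ] W} (hT : ∀ g x, T (ρ g x) = ρ' g (T x)) {A : Matrix (Fin 2) (Fin 2) ℂ}
    (hA : A.trace = 0) (x : V) : T (δ A x) = δ' A (T x) := by
  have hH := h.map_cartan_apply h' hT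
  let r : ℂ := ((Real.sqrt 2)⁻¹ : ℝ)
  have hr : r * r = 1 / 2 := by
    simp only [r]
    rw [← Complex.ofReal_mul, ← mul_inv, Real.mul_self_sqrt (by norm_num)]
    norm_num
  have hsr : star r = r := Complex.conj_ofReal _
  have hX : ∀ x, T (δ !![0, 1; 1, 0] x) = δ' !![0, 1; 1, 0] (T x) := by
    refine h.map_apply_of_conj h' (g := su2OfColumn r r (by rw [hsr, hr]; norm_num)) hT ?_ hH
    simp only [su2OfColumn, hsr]
    ext i j
    fin_cases i <;> fin_cases j <;> simp
  have hY : ∀ x, T (δ !![0, 2; -2, 0] x) = δ' !![0, 2; -2, 0] (T x) := by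
    intro x
    have e : (!![0, 2; -2, 0] : Matrix (Fin 2) (Fin 2) ℂ) =
        !![1, 0; 0, -1] * !![0, 1; 1, 0] - !![0, 1; 1, 0] * !![1, 0; 0, -1] := by
      ext i j
      fin_cases i <;> fin_cases j <;> simp <;> norm_num
    rw [e, h.lie, h'.lie, map_sub, hH, hX, hX, hH]
  have e : A = A 0 0 • !![1, 0; 0, -1] + ((A 0 1 + A 1 0) / 2) • !![0, 1; 1, 0] +
      ((A 0 1 - A 1 0) / 4) • !![0, 2; -2, 0] := by
    rw [Matrix.trace_fin_two] at hA
    ext i j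
    fin_cases i <;> fin_cases j <;> simp
    · ring
    · ring
    · linear_combination hA
  rw [e]
  simp only [map_add, map_smul, LinearMap.add_apply, LinearMap.smul_apply, hH, hX, hY]

/-- Write `g = u z u⁻¹` with `z` in the torus. Since `T` commutes with `u H u⁻¹`, the map `S = u⁻¹ T
u` commutes with `H`; so `S` preserves weights and commutes with `z`. No exponential map is needed.
-/
theorem intertwines_of_map_apply (h : IsSU2Action ρ δ b w) (h' : IsSU2Action ρ' δ' c w')
    {T : V →ₗ[ℂ] W} (hT : ∀ A : Matrix (Fin 2) (Fin 2) ℂ, A.trace = 0 →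
      ∀ x, T (δ A x) = δ' A (T x)) (g : SU2) (x : V) : T (ρ g x) = ρ' g (T x) := by
  obtain ⟨u, z, rfl⟩ := exists_conj_su2Torus g
  have hu : (u : Matrix (Fin 2) (Fin 2) ℂ) * ((u⁻¹ : SU2) : Matrix (Fin 2) (Fin 2) ℂ) = 1 :=
    congrArg Subtype.val (mul_inv_cancel u)
  have hu' : ((u⁻¹ : SU2) : Matrix (Fin 2) (Fin 2) ℂ) * u = 1 :=
    congrArg Subtype.val (inv_mul_cancel u)
  let B : Matrix (Fin 2) (Fin 2) ℂ :=
    (u : Matrix (Fin 2) (Fin 2) ℂ) * !![1, 0; 0, -1] * ((u⁻¹ : SU2) : Matrix (Fin 2) (Fin 2) ℂ)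
  have hB : B.trace = 0 := by
    simp only [B]
    rw [Matrix.trace_mul_comm, ← mul_assoc, hu', one_mul]
    simp [Matrix.trace_fin_two]
  have hBu : (u : Matrix (Fin 2) (Fin 2) ℂ) * !![1, 0; 0, -1] =
      B * (u : Matrix (Fin 2) (Fin 2) ℂ) := by
    simp only [B]
    rw [mul_assoc _ _ (u : Matrix (Fin 2) (Fin 2) ℂ), hu', mul_one]
  have hBu' : ((u⁻¹ : SU2) : Matrix (Fin 2) (Fin 2) ℂ) * B =
      !![1, 0; 0, -1] * ((u⁻¹ : SU2) : Matrix (Fin 2) (Fin 2) ℂ) := by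
    simp only [B]
    rw [← mul_assoc, ← mul_assoc, hu', one_mul]
  let S : V →ₗ[ℂ] W := ρ' u⁻¹ ∘ₗ T ∘ₗ ρ u
  have hS : ∀ x, S (δ !![1, 0; 0, -1] x) = δ' !![1, 0; 0, -1] (S x) := by
    intro x
    simp only [S, LinearMap.comp_apply]
    rw [h.conj u _ B hBu, hT B hB, h'.conj u⁻¹ B _ hBu']
  rw [intertwines_diagonal_iff h.weight h'.weight] at hS
  have hS' : ∀ x, S (ρ (su2Torus z) x) = ρ' (su2Torus z) (S x) := by
    rw [intertwines_diagonal_iff (h.torus z) (h'.torus z)]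
    intro i k
    by_cases h0 : c.repr (S (b i)) k = 0
    · rw [h0, mul_zero, mul_zero]
    · have : w i = w' k := by exact_mod_cast mul_right_cancel₀ h0 (hS i k)
      rw [this]
  have h1 := congrArg (ρ' u) (hS' (ρ u⁻¹ x))
  simp only [S, LinearMap.comp_apply, Representation.self_inv_apply] at h1
  simpa only [map_mul, Module.End.mul_apply] using h1

end IsSU2Action

end SU2Action

/-! ### Intertwiners correspond to primitive vectors. -/

section HighestWeight

open scoped TensorProduct

variable {V W κ : Type*} [AddCommGroup V] [Module ℂ V] [AddCommGroup W] [Module ℂ W]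
  {ρ : Representation ℂ SU2 V} {δ : Matrix (Fin 2) (Fin 2) ℂ →ₗ[ℂ] Module.End ℂ V}
  {ρ' : Representation ℂ SU2 W} {δ' : Matrix (Fin 2) (Fin 2) ℂ →ₗ[ℂ] Module.End ℂ W}
  {c : Module.Basis κ ℂ W} {w' : κ → ℤ}

/-- The basis `b` of a representation of dimension `D` is a single string of weight vectors. -/
structure IsIrrepBasis {D : ℕ} (ρ : Representation ℂ SU2 V)
    (δ : Matrix (Fin 2) (Fin 2) ℂ →ₗ[ℂ] Module.End ℂ V) (b : Module.Basis (Fin D) ℂ V) : Prop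
    extends IsSU2Action ρ δ b (irrepWeight D) where
  lower : ∀ i : Fin D, δ !![0, 0; 1, 0] (b i) =
    if h : 0 < (i : ℕ) then b ⟨i - 1, by omega⟩ else 0
  raise : ∀ i : Fin D, δ !![0, 1; 0, 0] (b i) =
    if h : (i : ℕ) + 1 < D then ((i + 1) * (D - 1 - i) : ℂ) • b ⟨i + 1, h⟩ else 0

namespace IsIrrepBasis

theorem toMatrix_lower {D : ℕ} {b : Module.Basis (Fin D) ℂ V} (h : IsIrrepBasis ρ δ b) :
    LinearMap.toMatrix b b (δ !![0, 0; 1, 0]) = nilpotentJordanCell D := by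
  ext i j
  rw [LinearMap.toMatrix_apply, h.lower, nilpotentJordanCell, Matrix.of_apply]
  split_ifs with h1 h2 h2
  · rw [Module.Basis.repr_self, Finsupp.single_apply, if_pos]
    exact Fin.ext (by simp; omega)
  · rw [Module.Basis.repr_self, Finsupp.single_apply, if_neg]
    intro h3
    have h4 := congrArg Fin.val h3
    simp at h4
    omega
  · omega
  · simp

theorem map_eq_lower_pow {n : ℕ} {b : Module.Basis (Fin (n + 1)) ℂ V} (h : IsIrrepBasis ρ δ b)
    (h' : IsSU2Action ρ' δ' c w') {T : V →ₗ[ℂ] W} (hT : ∀ g x, T (ρ g x) = ρ' g (T x)) (k : ℕ) :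
    ∀ i : Fin (n + 1), (i : ℕ) + k = n →
      T (b i) = (δ' !![0, 0; 1, 0] ^ k) (T (b (Fin.last n))) := by
  induction k with
  | zero =>
    intro i hi
    rw [show i = Fin.last n from Fin.ext (by simpa using hi)]
    simp
  | succ k ih =>
    intro i hi
    rw [pow_succ', Module.End.mul_apply, ← ih ⟨i + 1, by omega⟩ (by simp; omega),
      ← h.map_apply_of_intertwines h' hT (by simp [Matrix.trace_fin_two]), h.lower,
      dif_pos (by simp)]
    congr 1

/-- Evaluation at the highest weight vector `b (Fin.last n)` is an isomorphism. It is injective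
because lowering that vector produces the whole basis. -/
theorem finrank_intertwiningMap_of_finite [FiniteDimensional ℂ W] {n : ℕ}
    {b : Module.Basis (Fin (n + 1)) ℂ V} (h : IsIrrepBasis ρ δ b) (h' : IsSU2Action ρ' δ' c w') :
    Module.finrank ℂ (Representation.IntertwiningMap ρ ρ') =
      Module.finrank ℂ (primitiveSpace (δ' !![0, 1; 0, 0]) (δ' !![1, 0; 0, -1]) n) := by
  let f : Representation.IntertwiningMap ρ ρ' →ₗ[ℂ]
      primitiveSpace (δ' !![0, 1; 0, 0]) (δ' !![1, 0; 0, -1]) n :=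
    { toFun := fun T => ⟨T.toLinearMap (b (Fin.last n)), by
        have hT : ∀ g x, T.toLinearMap (ρ g x) = ρ' g (T.toLinearMap x) := T.isIntertwining
        rw [mem_primitiveSpace,
          ← h.map_apply_of_intertwines h' hT (by simp [Matrix.trace_fin_two]),
          ← h.map_apply_of_intertwines h' hT (by simp [Matrix.trace_fin_two]), h.raise,
          dif_neg (by simp), map_zero, h.weight, map_smul]
        refine ⟨rfl, ?_⟩
        congr 2
        simp only [irrepWeight, Fin.val_last]
        push_cast
        ring⟩
      map_add' := fun _ _ => rfl
      map_smul' := fun _ _ => rfl }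
  refine LinearEquiv.finrank_eq (LinearEquiv.ofBijective f ⟨?_, ?_⟩)
  · rw [← LinearMap.ker_eq_bot, LinearMap.ker_eq_bot']
    intro T hT
    have hT0 : T.toLinearMap (b (Fin.last n)) = 0 := congrArg Subtype.val hT
    refine Representation.IntertwiningMap.ext (b.ext fun i => ?_)
    rw [h.map_eq_lower_pow h' T.isIntertwining (n - i) i (by omega), hT0, map_zero]
    rfl
  · rintro ⟨u, hu⟩
    -- The only candidate with `b (Fin.last n) ↦ u`. Compatibility with `F` at the bottom of the
    -- string is `F ^ (n + 1) u = 0`; compatibility with `E` holds since both strings have the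
    -- raising coefficient `(i + 1)(n - i)`.
    let T : V →ₗ[ℂ] W := b.constr ℂ fun i => (δ' !![0, 0; 1, 0] ^ (n - i : ℕ)) u
    have hTb : ∀ i, T (b i) = (δ' !![0, 0; 1, 0] ^ (n - i : ℕ)) u := b.constr_basis ℂ _
    have ext' : ∀ A : Matrix (Fin 2) (Fin 2) ℂ, (∀ i, T (δ A (b i)) = δ' A (T (b i))) →
        ∀ x, T (δ A x) = δ' A (T x) := fun A hA =>
      LinearMap.congr_fun (b.ext hA : T ∘ₗ δ A = δ' A ∘ₗ T)
    have hF := ext' !![0, 0; 1, 0] fun i => by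
      rw [h.lower, hTb, ← Module.End.mul_apply, ← pow_succ']
      split_ifs with hi
      · rw [hTb]
        congr 2
        simp only
        omega
      · rw [map_zero, show n - (i : ℕ) + 1 = n + 1 by omega, h'.isSl2Action.lower_pow_eq_zero hu]
    have hH := ext' !![1, 0; 0, -1] fun i => by
      have := h'.isSl2Action.map_lower_pow hu.2 (n - i)
      rw [Module.End.mem_eigenspace_iff] at this
      rw [h.weight, map_smul, hTb, this]
      congr 2
      simp only [irrepWeight]
      omega
    have hE := ext' !![0, 1; 0, 0] fun i => by
      rw [h.raise, hTb]
      split_ifs with hi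
      · obtain ⟨k, hk⟩ : ∃ k, n - (i : ℕ) = k + 1 := ⟨n - i - 1, by omega⟩
        have hn : n = k + 1 + i := by omega
        rw [hk, h'.isSl2Action.raise_lower_pow_succ hu, map_smul, hTb]
        have hk' : n - (i + 1 : ℕ) = k := by omega
        simp only [hk']
        congr 1
        have hn' : (n : ℂ) = k + 1 + (i : ℕ) := by exact_mod_cast hn
        push_cast
        rw [hn']
        ring
      · rw [map_zero, show n - (i : ℕ) = 0 by omega, pow_zero, Module.End.one_apply,
          (mem_primitiveSpace.mp hu).1]
    have hT := h.intertwines_of_map_apply h' (T := T) fun A hA x => by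
      rw [IsSU2Action.apply_eq_of_trace_eq_zero δ hA, IsSU2Action.apply_eq_of_trace_eq_zero δ' hA]
      simp only [LinearMap.add_apply, LinearMap.smul_apply, map_add, map_smul, hE, hF, hH]
    refine ⟨T.intertwiningMap_of_isIntertwiningMap ρ ρ' hT, Subtype.ext ?_⟩
    change T (b (Fin.last n)) = u
    rw [hTb]
    simp

theorem finrank_intertwiningMap [FiniteDimensional ℂ W] {D : ℕ} (hD : 1 ≤ D)
    {b : Module.Basis (Fin D) ℂ V} (h : IsIrrepBasis ρ δ b) (h' : IsSU2Action ρ' δ' c w') :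
    Module.finrank ℂ (Representation.IntertwiningMap ρ ρ') =
      Module.finrank ℂ (primitiveSpace (δ' !![0, 1; 0, 0]) (δ' !![1, 0; 0, -1]) ((D : ℤ) - 1)) := by
  obtain ⟨n, rfl⟩ : ∃ n, D = n + 1 := ⟨D - 1, by omega⟩
  rw [h.finrank_intertwiningMap_of_finite h']
  rw [show ((n + 1 : ℕ) : ℤ) - 1 = n by push_cast; ring]

end IsIrrepBasis

end HighestWeight

/-! ### The model on homogeneous polynomials in two variables. -/

section Polynomials

open MvPolynomial

/-- The derivation of `ℂ[X₀, X₁]` given by the linear substitution `X_i ↦ ∑ j, A j i X_j`. -/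
noncomputable def polyDerivation (A : Matrix (Fin 2) (Fin 2) ℂ) :
    Derivation ℂ (MvPolynomial (Fin 2) ℂ) (MvPolynomial (Fin 2) ℂ) :=
  mkDerivation ℂ fun i => ∑ j, C (A j i) * X j

theorem polyDerivation_X (A : Matrix (Fin 2) (Fin 2) ℂ) (i : Fin 2) :
    polyDerivation A (X i) = ∑ j, C (A j i) * X j :=
  mkDerivation_X _ _ _

theorem polyDerivation_add (A B : Matrix (Fin 2) (Fin 2) ℂ) :
    polyDerivation (A + B) = polyDerivation A + polyDerivation B := by
  refine derivation_ext fun i => ?_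
  simp only [Derivation.add_apply, polyDerivation_X, Matrix.add_apply, map_add, add_mul,
    Finset.sum_add_distrib]

theorem polyDerivation_smul (a : ℂ) (A : Matrix (Fin 2) (Fin 2) ℂ) :
    polyDerivation (a • A) = a • polyDerivation A := by
  refine derivation_ext fun i => ?_
  simp only [Derivation.smul_apply, polyDerivation_X, Matrix.smul_apply, smul_eq_mul, map_mul,
    Finset.smul_sum, smul_eq_C_mul, mul_assoc]

theorem polyDerivation_lie (A B : Matrix (Fin 2) (Fin 2) ℂ) :
    polyDerivation (A * B - B * A) = ⁅polyDerivation A, polyDerivation B⁆ := by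
  refine derivation_ext fun i => ?_
  rw [Derivation.commutator_apply]
  simp only [polyDerivation_X, Fin.sum_univ_two, map_add, Derivation.leibniz, derivation_C,
    smul_eq_mul, Matrix.sub_apply, Matrix.mul_apply, map_sub, map_mul]
  ring

theorem su2Poly_X (g : SU2) (i : Fin 2) :
    su2Poly g (X i) = ∑ j, C ((g : Matrix (Fin 2) (Fin 2) ℂ) j i) * X j :=
  aeval_X _ _

theorem su2Poly_C (g : SU2) (a : ℂ) : su2Poly g (C a) = C a :=
  algHom_C (aeval fun i => ∑ j, C ((g : Matrix (Fin 2) (Fin 2) ℂ) j i) * X j) a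

theorem su2Poly_mul (g : SU2) (p q : MvPolynomial (Fin 2) ℂ) :
    su2Poly g (p * q) = su2Poly g p * su2Poly g q :=
  map_mul (aeval fun i => ∑ j, C ((g : Matrix (Fin 2) (Fin 2) ℂ) j i) * X j) p q

theorem su2Poly_pow (g : SU2) (p : MvPolynomial (Fin 2) ℂ) (n : ℕ) :
    su2Poly g (p ^ n) = su2Poly g p ^ n :=
  map_pow (aeval fun i => ∑ j, C ((g : Matrix (Fin 2) (Fin 2) ℂ) j i) * X j) p n

/-- Both sides obey the Leibniz rule twisted by the substitution `g`, so it suffices to compare them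
on the variables, where the identity is `g A = B g`. -/
theorem su2Poly_polyDerivation (g : SU2) (A B : Matrix (Fin 2) (Fin 2) ℂ)
    (h : (g : Matrix (Fin 2) (Fin 2) ℂ) * A = B * g) (p : MvPolynomial (Fin 2) ℂ) :
    su2Poly g (polyDerivation A p) = polyDerivation B (su2Poly g p) := by
  induction p using MvPolynomial.induction_on with
  | C a => simp [su2Poly_C]
  | add p q hp hq => simp only [map_add, hp, hq]
  | mul_X p i hp =>
    have hX : su2Poly g (polyDerivation A (X i)) = polyDerivation B (su2Poly g (X i)) := by
      have h0 := congrArg (C (σ := Fin 2)) (congrFun (congrFun h 0) i)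
      have h1 := congrArg (C (σ := Fin 2)) (congrFun (congrFun h 1) i)
      simp only [Matrix.mul_apply, Fin.sum_univ_two, map_add, map_mul] at h0 h1
      simp only [polyDerivation_X, su2Poly_X, Fin.sum_univ_two, map_add, Derivation.leibniz,
        derivation_C, smul_eq_mul, su2Poly_mul, su2Poly_C]
      linear_combination (X 0 : MvPolynomial (Fin 2) ℂ) * h0 + X 1 * h1
    simp only [Derivation.leibniz, map_add, smul_eq_mul, su2Poly_mul, hp, hX]

theorem polyDerivation_mem (A : Matrix (Fin 2) (Fin 2) ℂ) (n : ℕ) (p : MvPolynomial (Fin 2) ℂ)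
    (hp : p ∈ (su2HomogeneousPoly n).toSubmodule) :
    polyDerivation A p ∈ (su2HomogeneousPoly n).toSubmodule := by
  change p.IsHomogeneous n at hp
  change (polyDerivation A p).IsHomogeneous n
  rw [p.as_sum, map_sum]
  refine IsHomogeneous.sum _ _ _ fun s hs => ?_
  have hdeg : s.degree = n := by
    by_contra hne
    exact mem_support_iff.mp hs (hp.coeff_eq_zero hne)
  rw [polyDerivation, mkDerivation_monomial, smul_eq_C_mul]
  refine IsHomogeneous.C_mul (IsHomogeneous.sum _ _ _ fun i hi => ?_) _
  have hi' : Finsupp.single i 1 ≤ s :=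
    Finsupp.single_le_iff.mpr (Nat.one_le_iff_ne_zero.mpr (Finsupp.mem_support_iff.mp hi))
  have hsub := congrArg Finsupp.degree (tsub_add_cancel_of_le hi')
  rw [map_add, Finsupp.degree_single, hdeg] at hsub
  rw [← hsub]
  exact (isHomogeneous_monomial _ rfl).mul (IsHomogeneous.sum _ _ _ fun j _ =>
    (isHomogeneous_X ℂ j).C_mul _)

/-- The action of the Lie algebra on homogeneous polynomials. -/
noncomputable def polyAction (n : ℕ) : Matrix (Fin 2) (Fin 2) ℂ →ₗ[ℂ]
    Module.End ℂ (su2HomogeneousPoly n).toSubmodule where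
  toFun A := (polyDerivation A).toLinearMap.restrict (polyDerivation_mem A n)
  map_add' A B := by
    ext1 p
    exact Subtype.ext (Derivation.congr_fun (polyDerivation_add A B) p)
  map_smul' a A := by
    ext1 p
    exact Subtype.ext (Derivation.congr_fun (polyDerivation_smul a A) p)

/-- The divided power monomial `X₀ ^ i / i! * X₁ ^ j`. -/
noncomputable def dividedMonomial (i j : ℕ) : MvPolynomial (Fin 2) ℂ :=
  (i.factorial : ℂ)⁻¹ • (X 0 ^ i * X 1 ^ j)

theorem dividedMonomial_eq_monomial (i j : ℕ) :
    dividedMonomial i j =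
      monomial (Finsupp.single 0 i + Finsupp.single 1 j) (i.factorial : ℂ)⁻¹ := by
  rw [dividedMonomial, X_pow_eq_monomial, X_pow_eq_monomial, monomial_mul, smul_monomial]
  simp

theorem dividedMonomial_mem {i j n : ℕ} (h : i + j = n) :
    dividedMonomial i j ∈ (su2HomogeneousPoly n).toSubmodule := by
  change (dividedMonomial i j).IsHomogeneous n
  rw [dividedMonomial_eq_monomial]
  exact isHomogeneous_monomial _ (by simp [h])

/-- The factor `1 / i!` absorbs the exponent produced by differentiation. The coefficient is exactly
`1`, so `F` has the Jordan cell itself as its matrix. -/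
theorem polyDerivation_lower_dividedMonomial_succ (i j : ℕ) :
    polyDerivation !![0, 0; 1, 0] (dividedMonomial (i + 1) j) = dividedMonomial i (j + 1) := by
  simp only [dividedMonomial, Derivation.map_smul, Derivation.leibniz, Derivation.leibniz_pow,
    polyDerivation_X, Fin.sum_univ_two]
  have h : (((i + 1).factorial : ℂ))⁻¹ * (i + 1) = (i.factorial : ℂ)⁻¹ := by
    rw [Nat.factorial_succ]
    have := Nat.cast_add_one_ne_zero (R := ℂ) i
    push_cast
    field_simp
  rw [← h]
  simp [smul_eq_C_mul]
  ring

theorem polyDerivation_lower_dividedMonomial_zero (j : ℕ) :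
    polyDerivation !![0, 0; 1, 0] (dividedMonomial 0 j) = 0 := by
  simp [dividedMonomial, Derivation.leibniz_pow, polyDerivation_X, Fin.sum_univ_two]

theorem polyDerivation_raise_dividedMonomial_succ (i j : ℕ) :
    polyDerivation !![0, 1; 0, 0] (dividedMonomial i (j + 1)) =
      ((i + 1) * (j + 1) : ℂ) • dividedMonomial (i + 1) j := by
  simp only [dividedMonomial, Derivation.map_smul, Derivation.leibniz, Derivation.leibniz_pow,
    polyDerivation_X, Fin.sum_univ_two]
  have h : (((i + 1).factorial : ℂ))⁻¹ * (i + 1) = (i.factorial : ℂ)⁻¹ := by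
    rw [Nat.factorial_succ]
    have := Nat.cast_add_one_ne_zero (R := ℂ) i
    push_cast
    field_simp
  rw [← h]
  simp [smul_eq_C_mul]
  ring

theorem polyDerivation_raise_dividedMonomial_zero (i : ℕ) :
    polyDerivation !![0, 1; 0, 0] (dividedMonomial i 0) = 0 := by
  simp [dividedMonomial, Derivation.leibniz_pow, polyDerivation_X, Fin.sum_univ_two]

theorem polyDerivation_cartan_dividedMonomial (i j : ℕ) :
    polyDerivation !![1, 0; 0, -1] (dividedMonomial i j) =
      ((i : ℂ) - j) • dividedMonomial i j := by
  -- For `n = 0` the truncated exponent `n - 1` is wrong, but the factor `n` vanishes.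
  have h : ∀ (k : Fin 2) (n : ℕ), (n : MvPolynomial (Fin 2) ℂ) * (X k ^ (n - 1) * X k) =
      (n : MvPolynomial (Fin 2) ℂ) * X k ^ n := by
    intro k n
    cases n with
    | zero => simp
    | succ n => rw [Nat.add_sub_cancel, pow_succ]
  have h0 := h 0 i
  have h1 := h 1 j
  simp only [dividedMonomial, Derivation.map_smul, Derivation.leibniz, Derivation.leibniz_pow,
    polyDerivation_X, Fin.sum_univ_two]
  rw [smul_comm ((i : ℂ) - j)]
  refine congrArg (fun p : MvPolynomial (Fin 2) ℂ => (i.factorial : ℂ)⁻¹ • p) ?_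
  simp [smul_eq_C_mul]
  linear_combination X 1 ^ j * h0 - X 0 ^ i * h1

theorem su2Poly_torus_dividedMonomial (z : Circle) (i j : ℕ) :
    su2Poly (su2Torus z) (dividedMonomial i j) = (z : ℂ) ^ ((i : ℤ) - j) • dividedMonomial i j := by
  rw [dividedMonomial, map_smul, smul_comm, su2Poly_mul, su2Poly_pow, su2Poly_pow, su2Poly_X,
    su2Poly_X, zpow_sub₀ z.coe_ne_zero, zpow_natCast, zpow_natCast]
  refine congrArg (fun p : MvPolynomial (Fin 2) ℂ => (i.factorial : ℂ)⁻¹ • p) ?_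
  simp only [su2Torus, Fin.sum_univ_two, smul_eq_C_mul, div_eq_mul_inv, map_mul, ← inv_pow,
    map_pow, Matrix.of_apply, Matrix.cons_val', Matrix.cons_val_zero, Matrix.cons_val_one,
    Matrix.cons_val_fin_one, map_zero, zero_mul, add_zero, zero_add, mul_pow]
  ring

/-- The divided power monomials of degree `d - 1`, as elements of the irreducible representation. -/
noncomputable def irrepVector (d : ℕ) (i : Fin d) : (su2HomogeneousPoly (d - 1)).toSubmodule :=
  ⟨dividedMonomial i (d - 1 - i), dividedMonomial_mem (by omega)⟩

theorem coeff_irrepVector (d : ℕ) (i : Fin d) (s : Fin 2 →₀ ℕ) :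
    coeff s (irrepVector d i : MvPolynomial (Fin 2) ℂ) =
      if Finsupp.single 0 (i : ℕ) + Finsupp.single 1 (d - 1 - i : ℕ) = s then
        ((i : ℕ).factorial : ℂ)⁻¹ else 0 := by
  change coeff s (dividedMonomial i (d - 1 - i)) = _
  rw [dividedMonomial_eq_monomial, coeff_monomial]

theorem linearIndependent_irrepVector (d : ℕ) : LinearIndependent ℂ (irrepVector d) := by
  rw [Fintype.linearIndependent_iff]
  intro c hc k
  have h1 := congrArg (coeff (Finsupp.single 0 (k : ℕ) + Finsupp.single 1 (d - 1 - k : ℕ)))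
    (congrArg Subtype.val hc)
  rw [Submodule.coe_sum, coeff_sum, Finset.sum_eq_single k] at h1
  · rw [Submodule.coe_smul, coeff_smul, coeff_irrepVector,
      if_pos rfl, smul_eq_mul, Submodule.coe_zero, coeff_zero, mul_eq_zero] at h1
    exact h1.resolve_right (inv_ne_zero (by exact_mod_cast Nat.factorial_ne_zero _))
  · intro i _ hik
    rw [Submodule.coe_smul, coeff_smul, coeff_irrepVector,
      if_neg, smul_zero]
    intro h
    have := DFunLike.congr_fun h 0
    simp at this
    exact hik (Fin.ext this)
  · simp

/-- Each monomial of degree `d - 1` is a scalar multiple of some `irrepVector`. For `d = 0` this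
fails: `d - 1` truncates to `0`, leaving the constants with an empty family. -/
theorem span_irrepVector {d : ℕ} (hd : 1 ≤ d) :
    ⊤ ≤ Submodule.span ℂ (Set.range (irrepVector d)) := by
  rintro ⟨p, hp⟩ -
  have hp' : p.IsHomogeneous (d - 1) := hp
  have key : p ∈ (Submodule.span ℂ (Set.range (irrepVector d))).map
      (su2HomogeneousPoly (d - 1)).toSubmodule.subtype := by
    rw [p.as_sum]
    refine Submodule.sum_mem _ fun s hs => ?_
    have hdeg : s.degree = d - 1 := by
      by_contra hne
      exact mem_support_iff.mp hs (hp'.coeff_eq_zero hne)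
    rw [Finsupp.degree_eq_sum, Fin.sum_univ_two] at hdeg
    let i : Fin d := ⟨s 0, by omega⟩
    refine ⟨(coeff s p * (s 0).factorial) • irrepVector d i,
      Submodule.smul_mem _ _ (Submodule.subset_span ⟨i, rfl⟩), ?_⟩
    have hs' : Finsupp.single 0 (s 0) + Finsupp.single 1 (d - 1 - s 0) = s := by
      ext j
      fin_cases j
      · simp
      · simp
        omega
    simp only [Submodule.subtype_apply, Submodule.coe_smul, irrepVector,
      dividedMonomial_eq_monomial, smul_monomial, i, hs', smul_eq_mul]
    rw [mul_assoc, mul_inv_cancel₀ (by exact_mod_cast Nat.factorial_ne_zero _), mul_one]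
  obtain ⟨q, hq, hqp⟩ := key
  have : q = ⟨p, hp⟩ := Subtype.ext hqp
  exact this ▸ hq

/-- The basis of the irreducible representation of dimension `d` by divided power monomials. -/
noncomputable def irrepBasis (d : ℕ) (hd : 1 ≤ d) :
    Module.Basis (Fin d) ℂ (su2HomogeneousPoly (d - 1)).toSubmodule :=
  Module.Basis.mk (linearIndependent_irrepVector d) (span_irrepVector hd)

theorem coe_irrepBasis {d : ℕ} (hd : 1 ≤ d) (i : Fin d) :
    (irrepBasis d hd i : MvPolynomial (Fin 2) ℂ) = dividedMonomial i (d - 1 - i) := by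
  rw [irrepBasis, Module.Basis.mk_apply]
  rfl

theorem isIrrepBasis_su2Irrep {d : ℕ} (hd : 1 ≤ d) :
    IsIrrepBasis (su2Irrep d) (polyAction (d - 1)) (irrepBasis d hd) where
  lie A B p := by
    refine Subtype.ext ((Derivation.congr_fun (polyDerivation_lie A B) p).trans ?_)
    exact Derivation.commutator_apply _
  conj g A B h p := Subtype.ext (su2Poly_polyDerivation g A B h p)
  weight i := by
    refine Subtype.ext ?_
    change polyDerivation _ (irrepBasis d hd i : MvPolynomial (Fin 2) ℂ) =
      _ • (irrepBasis d hd i : MvPolynomial (Fin 2) ℂ)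
    rw [coe_irrepBasis, polyDerivation_cartan_dividedMonomial]
    congr 1
    have : ((d - 1 - i : ℕ) : ℤ) = d - 1 - i := by omega
    have h : ((d - 1 - i : ℕ) : ℂ) = d - 1 - (i : ℕ) := by
      exact_mod_cast congrArg (Int.cast (R := ℂ)) this
    rw [h, irrepWeight]
    push_cast
    ring
  torus z i := by
    refine Subtype.ext ?_
    change su2Poly _ (irrepBasis d hd i : MvPolynomial (Fin 2) ℂ) =
      _ • (irrepBasis d hd i : MvPolynomial (Fin 2) ℂ)
    rw [coe_irrepBasis, su2Poly_torus_dividedMonomial]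
    congr 2
    rw [irrepWeight]
    omega
  lower i := by
    refine Subtype.ext ?_
    change polyDerivation _ (irrepBasis d hd i : MvPolynomial (Fin 2) ℂ) = _
    rw [coe_irrepBasis]
    split_ifs with hi
    · obtain ⟨k, hk⟩ : ∃ k, (i : ℕ) = k + 1 := ⟨i - 1, by omega⟩
      rw [coe_irrepBasis]
      simp only [hk, polyDerivation_lower_dividedMonomial_succ]
      congr 1
      omega
    · rw [show (i : ℕ) = 0 by omega, polyDerivation_lower_dividedMonomial_zero]
      rfl
  raise i := by
    refine Subtype.ext ?_
    change polyDerivation _ (irrepBasis d hd i : MvPolynomial (Fin 2) ℂ) = _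
    rw [coe_irrepBasis]
    split_ifs with hi
    · obtain ⟨k, hk⟩ : ∃ k, d - 1 - (i : ℕ) = k + 1 := ⟨d - 1 - i - 1, by omega⟩
      have hd' : (d : ℂ) = k + 1 + 1 + (i : ℕ) := by
        have : d = k + 1 + 1 + i := by omega
        exact_mod_cast this
      rw [Submodule.coe_smul, coe_irrepBasis, hk, polyDerivation_raise_dividedMonomial_succ]
      congr 1
      · rw [hd']
        ring
      · congr 1
        simp only
        omega
    · rw [show d - 1 - (i : ℕ) = 0 by omega, polyDerivation_raise_dividedMonomial_zero]
      rfl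

end Polynomials

/-! ### Assembly: one multiplicity function serves all three descriptions. -/

theorem exists_multiplicity_of_isIrrepBasis {V₀ V₁ V₂ V₃ : Type*} [AddCommGroup V₀] [Module ℂ V₀]
    [AddCommGroup V₁] [Module ℂ V₁] [AddCommGroup V₂] [Module ℂ V₂] [AddCommGroup V₃] [Module ℂ V₃]
    (d : Fin 4 → ℕ)
    {ρ₀ : Representation ℂ SU2 V₀} {δ₀ : Matrix (Fin 2) (Fin 2) ℂ →ₗ[ℂ] Module.End ℂ V₀}
    {b₀ : Module.Basis (Fin (d 0)) ℂ V₀} (h₀ : IsIrrepBasis ρ₀ δ₀ b₀)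
    {ρ₁ : Representation ℂ SU2 V₁} {δ₁ : Matrix (Fin 2) (Fin 2) ℂ →ₗ[ℂ] Module.End ℂ V₁}
    {b₁ : Module.Basis (Fin (d 1)) ℂ V₁} (h₁ : IsIrrepBasis ρ₁ δ₁ b₁)
    {ρ₂ : Representation ℂ SU2 V₂} {δ₂ : Matrix (Fin 2) (Fin 2) ℂ →ₗ[ℂ] Module.End ℂ V₂}
    {b₂ : Module.Basis (Fin (d 2)) ℂ V₂} (h₂ : IsIrrepBasis ρ₂ δ₂ b₂)
    {ρ₃ : Representation ℂ SU2 V₃} {δ₃ : Matrix (Fin 2) (Fin 2) ℂ →ₗ[ℂ] Module.End ℂ V₃}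
    {b₃ : Module.Basis (Fin (d 3)) ℂ V₃} (h₃ : IsIrrepBasis ρ₃ δ₃ b₃) :
    ∃ C : ℕ → ℕ,
      (∀ D : ℕ, 1 ≤ D → (C D : ℝ) = characterIntegral d D ∧
        C D = Module.finrank ℂ (Representation.IntertwiningMap (su2Irrep D)
          (((ρ₀.tprod ρ₁).tprod ρ₂).tprod ρ₃))) ∧
      IsSimilar (jordanCellSum d) (jordanDirectSum ((∑ α, d α) - 3) C) := by
  have h := ((h₀.toIsSU2Action.tprod h₁.toIsSU2Action).tprod h₂.toIsSU2Action).tprod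
    h₃.toIsSU2Action
  have := Module.Finite.of_basis
    (((b₀.tensorProduct b₁).tensorProduct b₂).tensorProduct b₃)
  -- The witness left to unification is the dimension of the space of primitive vectors of weight `D
  -- - 1`.
  refine ⟨_, fun D hD => ⟨?_, ((isIrrepBasis_su2Irrep hD).finrank_intertwiningMap hD h).symm⟩, ?_⟩
  · have h1 := h.finrank_primitiveSpace_add (μ := (D : ℤ) - 1) (by omega)
    rw [show (D : ℤ) - 1 + 2 = D + 1 by ring] at h1
    rw [characterIntegral_eq, ← h1]
    push_cast
    ring
  · convert h.isSimilar_jordanDirectSum ((∑ α, d α) - 3) (tensorWeight_lt d) using 1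
    rw [toMatrix_tensorAction, toMatrix_tensorAction, toMatrix_tensorAction, h₀.toMatrix_lower,
      h₁.toMatrix_lower, h₂.toMatrix_lower, h₃.toMatrix_lower]
    rfl

theorem mainTheorem6 (d : Fin 4 → ℕ) (hd : ∀ α, 1 ≤ d α) :
    (∀ D : ℕ, IntervalIntegrable (characterIntegrand d D) MeasureTheory.volume 0 (2 * Real.pi)) ∧
    (∃ C : ℕ → ℕ,
      (∀ D : ℕ, 1 ≤ D →
        (C D : ℝ) = characterIntegral d D ∧ C D = clebschGordanMultiplicity d D) ∧
      IsSimilar (jordanCellSum d) (jordanDirectSum ((∑ α, d α) - 3) C)) ∧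
    (∀ D : ℕ, Even ((D : ℤ) - ∑ α, (d α : ℤ)) → characterIntegral d D = 0) :=
  ⟨fun D => intervalIntegrable_characterIntegrand d D _ _,
    exists_multiplicity_of_isIrrepBasis d (isIrrepBasis_su2Irrep (hd 0))
      (isIrrepBasis_su2Irrep (hd 1)) (isIrrepBasis_su2Irrep (hd 2)) (isIrrepBasis_su2Irrep (hd 3)),
    characterIntegral_eq_zero_of_even d⟩
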